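/- **Lemma 2.2 (Wegner estimate for $K_\Lambda$).** Let $\lambda\in\mathbb R$ and let $g$ be a probability measure on $\mathbb R$ with $\operatorname{supp} g\subset[-1,1]$ that is absolutely continuous with a bounded density. Then there is a constant $C>0$, depending only on $\lambda$ and $g$, such that the following holds. Let $d\ge 1$, $\gamma>0$, $\omega>0$ with $\omega\le 2d+\gamma$, let $b>0$, and let $W:\mathbb Z^d\to\mathbb R$ satisfy $|W(j)|\le e^{-b(\log\gamma)|j|}$ for all $j$, where $|\cdot|$ is the $\ell^1$ norm. Let $(v_j)_{j\in\mathbb Z^d}$ be i.i.d. real random variables with distribution $g$, put $V=\operatorname{diag}(v_j)$, and let $\Delta(i,j)=1$ if $|i-j|=1$ and $\Delta(i,j)=0$ otherwise. For a finite set $\Lambda\subset\mathbb Z^d$ let $\Delta_\Lambda=(\Delta(i,j))_{i,j\in\Lambda}$ and let $$K_\Lambda=\frac{\omega}{i}\frac{\partial}{\partial\theta}+\Delta_\Lambda+\gamma V+\lambda\cos(2\pi\theta)\,W$$ on $\ell^2(\Lambda)\otimes L^2(S^1)$, $S^1=\mathbb R/\mathbb Z$, with domain $\ell^2(\Lambda)\otimes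 H^1(S^1)$. Then for all finite $\Lambda\subset\mathbb Z^d$, $E\in\mathbb R$ and $\epsilon>0$, $$\operatorname{Prob}\big(\operatorname{dist}(E,\sigma(K_\Lambda))\le\epsilon\big)\le C\,\frac{\epsilon}{\omega}\,|\Lambda|^4\,\frac{2d+\gamma}{\gamma}.$$ -/

import Mathlib

open MeasureTheory AddCircle Set
open scoped ENNReal NNReal

noncomputable section

namespace QuasiEnergy

/-- `L²(S¹)`, where `S¹ = ℝ / ℤ` carries its Haar probability measure (Lebesgue measure on a
period). -/
abbrev L2Circle : Type := Lp ℂ 2 (haarAddCircle : Measure UnitAddCircle)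

/-- `g` is the weak derivative `∂f/∂θ` of `f` in `L²(S¹)`: testing against all exponentials
`exp (- 2πi n θ)`, the `n`-th Fourier coefficient of `g` is `2πi n` times that of `f`. -/
def IsWeakDeriv (f g : L2Circle) : Prop :=
  ∀ n : ℤ, fourierCoeff g n = 2 * Real.pi * Complex.I * n * fourierCoeff f n

theorem isWeakDeriv_iff (f g : L2Circle) : IsWeakDeriv f g ↔
    ∀ n : ℤ, fourierBasis.repr g n = 2 * Real.pi * Complex.I * n * fourierBasis.repr f n := by
  simp only [IsWeakDeriv, fourierBasis_repr]

theorem IsWeakDeriv.unique {f g g' : L2Circle} (h : IsWeakDeriv f g) (h' : IsWeakDeriv f g') :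
    g = g' := by
  rw [isWeakDeriv_iff] at h h'
  apply fourierBasis.repr.injective
  ext n
  rw [h n, h' n]

theorem IsWeakDeriv.add {f g f' g' : L2Circle} (h : IsWeakDeriv f g) (h' : IsWeakDeriv f' g') :
    IsWeakDeriv (f + f') (g + g') := by
  rw [isWeakDeriv_iff] at *
  intro n
  simp only [map_add, lp.coeFn_add, Pi.add_apply, h n, h' n]
  ring

theorem IsWeakDeriv.smul {f g : L2Circle} (c : ℂ) (h : IsWeakDeriv f g) :
    IsWeakDeriv (c • f) (c • g) := by
  rw [isWeakDeriv_iff] at *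
  intro n
  simp only [map_smul, lp.coeFn_smul, Pi.smul_apply, smul_eq_mul, h n]
  ring

theorem isWeakDeriv_zero : IsWeakDeriv 0 0 := by
  rw [isWeakDeriv_iff]
  intro n
  simp

/-- The Sobolev space `H¹(S¹)`: the functions in `L²(S¹)` with a weak derivative in `L²(S¹)`. -/
def sobolevH1 : Submodule ℂ L2Circle where
  carrier := {f | ∃ g, IsWeakDeriv f g}
  add_mem' := by
    rintro f f' ⟨g, h⟩ ⟨g', h'⟩
    exact ⟨g + g', h.add h'⟩
  zero_mem' := ⟨0, isWeakDeriv_zero⟩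
  smul_mem' := by
    rintro c f ⟨g, h⟩
    exact ⟨c • g, h.smul c⟩

/-- The derivative `∂/∂θ : H¹(S¹) → L²(S¹)`. -/
def derivTheta : sobolevH1 →ₗ[ℂ] L2Circle where
  toFun f := f.2.choose
  map_add' f f' :=
    (f + f').2.choose_spec.unique (f.2.choose_spec.add f'.2.choose_spec)
  map_smul' c f := (c • f).2.choose_spec.unique (f.2.choose_spec.smul c)

theorem derivTheta_eq_iff (f : sobolevH1) (g : L2Circle) :
    derivTheta f = g ↔ IsWeakDeriv f g :=
  ⟨fun h => h ▸ f.2.choose_spec, fun h => f.2.choose_spec.unique h⟩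

/-- The continuous function `θ ↦ cos 2πθ` on `S¹ = ℝ / ℤ`, as the real part of
`exp (2πi θ)`. -/
def cosFun : C(UnitAddCircle, ℂ) where
  toFun θ := ((fourier 1 θ).re : ℂ)
  continuous_toFun := by fun_prop

theorem cosFun_coe (x : ℝ) : cosFun (x : UnitAddCircle) = (Real.cos (2 * Real.pi * x) : ℂ) := by
  simp only [cosFun, ContinuousMap.coe_mk]
  rw [fourier_coe_apply]
  norm_cast
  rw [← Complex.exp_ofReal_mul_I_re]
  congr 2
  push_cast
  ring

/-- Multiplication by `cos 2πθ` on `L²(S¹)`. -/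
def mulCos : L2Circle →L[ℂ] L2Circle :=
  (ContinuousLinearMap.mul ℂ ℂ).holderL haarAddCircle ∞ 2 2
    (ContinuousMap.toLp (E := ℂ) ∞ haarAddCircle ℂ cosFun)

theorem coeFn_mulCos (f : L2Circle) :
    mulCos f =ᵐ[haarAddCircle] fun θ => cosFun θ * f θ := by
  have h1 := ContinuousMap.coeFn_toLp (p := ∞) (𝕜 := ℂ)
    (haarAddCircle : Measure UnitAddCircle) cosFun
  have h2 := ContinuousLinearMap.coeFn_holder (r := 2) (ContinuousLinearMap.mul ℂ ℂ)
    (ContinuousMap.toLp (E := ℂ) ∞ (haarAddCircle : Measure UnitAddCircle) ℂ cosFun) f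
  filter_upwards [h1, h2] with θ a b
  have : mulCos f = (ContinuousLinearMap.mul ℂ ℂ).holder 2
    (ContinuousMap.toLp (E := ℂ) ∞ (haarAddCircle : Measure UnitAddCircle) ℂ cosFun) f := rfl
  rw [this, b, a]
  rfl

/-- The `ℓ¹` norm on `ℤ^d`. -/
def l1Norm {d : ℕ} (j : Fin d → ℤ) : ℤ := ∑ k, |j k|

/-- The matrix elements `Δ(i, j)` of the discrete Laplacian on `ℤ^d`: `1` if `|i - j| = 1` in the
`ℓ¹` norm, and `0` otherwise. -/
def laplacian {d : ℕ} (i j : Fin d → ℤ) : ℂ := if l1Norm (i - j) = 1 then 1 else 0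

/-- The Hilbert space `ℓ²(Λ) ⊗ L²(S¹)`, as the Hilbert sum of copies of `L²(S¹)` over the sites
of `Λ`. -/
abbrev BoxSpace {d : ℕ} (Λ : Finset (Fin d → ℤ)) : Type := PiLp 2 fun _ : Λ => L2Circle

/-- The quasi-energy operator
`K_Λ = (ω / i) ∂/∂θ + Δ_Λ + γ V + λ cos(2πθ) W` on `ℓ²(Λ) ⊗ L²(S¹)`, as an unbounded operator with
domain `ℓ²(Λ) ⊗ H¹(S¹)`; here `V = diag (v_j)` and `W = diag (W(j))`. -/
def quasiEnergy {d : ℕ} (Λ : Finset (Fin d → ℤ)) (ω γ lam : ℝ) (v W : (Fin d → ℤ) → ℝ) :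
    BoxSpace Λ →ₗ.[ℂ] BoxSpace Λ where
  domain :=
    { carrier := {ψ | ∀ j, ψ j ∈ sobolevH1}
      add_mem' := fun h h' j => sobolevH1.add_mem (h j) (h' j)
      zero_mem' := fun _ => sobolevH1.zero_mem
      smul_mem' := fun c _ h j => sobolevH1.smul_mem c (h j) }
  toFun :=
    { toFun := fun ψ => WithLp.toLp 2 fun j : Λ =>
        ((ω : ℂ) / Complex.I) • derivTheta ⟨ψ.1 j, ψ.2 j⟩
          + ∑ i : Λ, laplacian (j : Fin d → ℤ) i • ψ.1 i
          + ((γ * v j : ℝ) : ℂ) • ψ.1 j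
          + ((lam * W j : ℝ) : ℂ) • mulCos (ψ.1 j)
      map_add' := by
        intro ψ φ
        ext1 j
        have h : derivTheta ⟨ψ.1 j + φ.1 j, sobolevH1.add_mem (ψ.2 j) (φ.2 j)⟩
            = derivTheta ⟨ψ.1 j, ψ.2 j⟩ + derivTheta ⟨φ.1 j, φ.2 j⟩ := by
          rw [← map_add]; rfl
        simp only [PiLp.add_apply, Submodule.coe_add, smul_add, map_add,
          Finset.sum_add_distrib]
        rw [h, smul_add]
        abel
      map_smul' := by
        intro c ψ
        ext1 j
        have h : derivTheta ⟨c • ψ.1 j, sobolevH1.smul_mem c (ψ.2 j)⟩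
            = c • derivTheta ⟨ψ.1 j, ψ.2 j⟩ := by
          rw [← map_smul]; rfl
        simp only [PiLp.smul_apply, Submodule.coe_smul, map_smul, smul_add, smul_comm c,
          Finset.smul_sum, RingHom.id_apply]
        rw [h] }

theorem quasiEnergy_apply {d : ℕ} (Λ : Finset (Fin d → ℤ)) (ω γ lam : ℝ)
    (v W : (Fin d → ℤ) → ℝ) (ψ : (quasiEnergy Λ ω γ lam v W).domain) (j : Λ) :
    (quasiEnergy Λ ω γ lam v W ψ) j =
      ((ω : ℂ) / Complex.I) • derivTheta ⟨ψ.1 j, ψ.2 j⟩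
        + ∑ i : Λ, laplacian (j : Fin d → ℤ) i • ψ.1 i
        + ((γ * v j : ℝ) : ℂ) • ψ.1 j
        + ((lam * W j : ℝ) : ℂ) • mulCos (ψ.1 j) :=
  rfl

/-- The spectrum of an unbounded operator `T` on a complex normed space: the complement of the set
of those `z` for which `T - z` is a bijection from the domain of `T` onto the whole space with a
bounded inverse `R`. -/
def unboundedSpectrum {H : Type*} [NormedAddCommGroup H] [NormedSpace ℂ H] (T : H →ₗ.[ℂ] H) :
    Set ℂ :=
  {z | ∃ R : H →L[ℂ] H,
    (∀ x : H, ∃ h : R x ∈ T.domain, T ⟨R x, h⟩ - z • R x = x) ∧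
    (∀ x : T.domain, R (T x - z • (x : H)) = x)}ᶜ

/-- `g` is absolutely continuous with a bounded density. -/
def HasBoundedDensity (g : Measure ℝ) : Prop :=
  ∃ ρ : ℝ → ℝ≥0∞, Measurable ρ ∧ (∃ M : ℝ≥0, ∀ᵐ x, ρ x ≤ M) ∧ g = volume.withDensity ρ

/-- The law `P = ∏_j g(dv_j)` of the i.i.d. potential `v = (v_j)` on `Ω = ℝ^(ℤ^d)`. -/
def potentialLaw (d : ℕ) (g : Measure ℝ) [IsProbabilityMeasure g] :
    Measure ((Fin d → ℤ) → ℝ) :=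
  Measure.infinitePi fun _ => g

end QuasiEnergy

end

/-! An eigenfunction of $K_\Lambda$ at $z$ is a periodic solution of a linear ODE on $\mathbb
C^\Lambda$. Removing the factor $e^{iz\theta/\omega}$ turns this ODE into $w'=-i(G(\theta)+aV)w$
with $G=\omega^{-1}(\Delta_\Lambda+\lambda\cos(2\pi\theta)W)$ and $a=\gamma/\omega$. So
$e^{-iz/\omega}$ is an eigenvalue of the unitary monodromy matrix $U=X(1)$
(`exists_monodromy_eigenvector`). The spectrum consists of eigenvalues because the resolvent of
$(\omega/i)\partial_\theta$ is compact (`exists_eigenvector`). It remains to bound the probability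
that $U$ has an eigenvalue in an arc of length of order $t=\epsilon/\omega$.

For this, put $\rho=(1-t)e^{iE/\omega}$ and $S=(1-\rho U)^{-1}$. The Poisson kernel
$\mathrm{Re}\,\mathrm{tr}(2S-1)$ is at least of order $1/t$ when such an eigenvalue exists
(`le_sum_poissonDensity`), so by Markov's inequality it suffices to bound its mean independently of
$t$.

Let $Q_j=\int_0^1 X^*P_jX\,d\theta$. These matrices are positive, have trace 1 and sum to 1, and
Duhamel's formula gives $\partial U/\partial v_j=-ia\,UQ_j$ (`hasDerivAt_monodromy`). Hence the
nonnegative summand $\mathrm{Re}\,\mathrm{tr}((2S-1)Q_j)$ is the $v_j$-derivative of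
$v_j+(2/a)\,\mathrm{Im}\log\det(1-\rho U)$. Each eigenvalue of $1-\rho U$ lies in the right
half-plane, so the argument of the determinant, taken as a sum of principal arguments, is at most
$|\Lambda|\pi/2$ in modulus. The integral over $v_j\in[-1,1]$ is therefore at most
$2+2\pi|\Lambda|/a$ (`integral_poissonDensity_le`). Bounded density and a sum over $j$ finish the
estimate, with $|\Lambda|^2$ in place of $|\Lambda|^4$. -/

noncomputable section

namespace QuasiEnergy

/-! ### Dyson series for linear equations in a Banach algebra. -/

section Propagator

variable {𝔸 : Type*} [NormedRing 𝔸] [NormedAlgebra ℝ 𝔸]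

/-- The `k`-th term of the Dyson series of the linear equation `X' = B X`, `X 0 = 1`. -/
def dysonTerm (B : ℝ → 𝔸) : ℕ → ℝ → 𝔸
  | 0 => fun _ => 1
  | k + 1 => fun t => ∫ s in (0 : ℝ)..t, B s * dysonTerm B k s

/-- The propagator of the linear equation `X' = B X`, `X 0 = 1`. -/
def propagator (B : ℝ → 𝔸) (t : ℝ) : 𝔸 := ∑' k, dysonTerm B k t

theorem continuous_dysonTerm {B : ℝ → 𝔸} (hB : Continuous B) (k : ℕ) :
    Continuous (dysonTerm B k) := by
  induction k with
  | zero => exact continuous_const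
  | succ k ih =>
    exact intervalIntegral.continuous_primitive (fun a b => (hB.mul ih).intervalIntegrable a b) 0

theorem hasDerivAt_dysonTerm_succ [CompleteSpace 𝔸] {B : ℝ → 𝔸} (hB : Continuous B) (k : ℕ) (t : ℝ) :
    HasDerivAt (dysonTerm B (k + 1)) (B t * dysonTerm B k t) t := by
  have h : Continuous fun s => B s * dysonTerm B k s := hB.mul (continuous_dysonTerm hB k)
  exact intervalIntegral.integral_hasDerivAt_right (h.intervalIntegrable 0 t)
    h.aestronglyMeasurable.stronglyMeasurableAtFilter h.continuousAt

/-- The factor `‖1‖` is kept because `‖1‖ = 1` is not assumed; it fails for matrices over an empty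
index set. -/
theorem norm_dysonTerm_le {B : ℝ → 𝔸} {β : ℝ} (hβ : ∀ t, ‖B t‖ ≤ β) (hB : Continuous B)
    (k : ℕ) (t : ℝ) : ‖dysonTerm B k t‖ ≤ ‖(1 : 𝔸)‖ * ((β * |t|) ^ k / k.factorial) := by
  have hβ0 : 0 ≤ β := (norm_nonneg _).trans (hβ 0)
  induction k generalizing t with
  | zero => simp [dysonTerm]
  | succ k ih =>
    have hint : ∀ f : ℝ → ℝ, Continuous f → IntegrableOn f (uIoc 0 t) := fun f hf =>
      (hf.integrableOn_uIcc).mono_set uIoc_subset_uIcc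
    calc ‖dysonTerm B (k + 1) t‖ ≤ ∫ s in uIoc 0 t, ‖B s * dysonTerm B k s‖ :=
          intervalIntegral.norm_integral_le_integral_norm_uIoc
      _ ≤ ∫ s in uIoc 0 t, ‖(1 : 𝔸)‖ * (β ^ (k + 1) / k.factorial) * |s - 0| ^ k := by
          apply setIntegral_mono
          · exact hint _ (hB.mul (continuous_dysonTerm hB k)).norm
          · exact hint _ (by fun_prop)
          · intro s
            calc ‖B s * dysonTerm B k s‖ ≤ ‖B s‖ * ‖dysonTerm B k s‖ := norm_mul_le _ _
              _ ≤ β * (‖(1 : 𝔸)‖ * ((β * |s|) ^ k / k.factorial)) :=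
                  mul_le_mul (hβ s) (ih s) (norm_nonneg _) hβ0
              _ = _ := by simp only [sub_zero, mul_pow, pow_succ]; ring
      _ = _ := by
          rw [integral_const_mul, integral_pow_abs_sub_uIoc, sub_zero, Nat.factorial_succ]
          push_cast
          rw [mul_pow]
          field_simp

theorem hasDerivAt_propagator [CompleteSpace 𝔸] {B : ℝ → 𝔸} {β : ℝ} (hβ : ∀ t, ‖B t‖ ≤ β) (hB : Continuous B)
    (t : ℝ) : HasDerivAt (propagator B) (B t * propagator B t) t := by
  have hβ0 : 0 ≤ β := (norm_nonneg _).trans (hβ 0)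
  have hsum : ∀ t, Summable fun k => dysonTerm B k t := fun t =>
    Summable.of_norm_bounded ((Real.summable_pow_div_factorial _).mul_left _)
      fun k => norm_dysonTerm_le hβ hB k t
  have hshift : propagator B = fun t => 1 + ∑' k, dysonTerm B (k + 1) t := by
    funext t
    rw [propagator, (hsum t).tsum_eq_zero_add]
    rfl
  have hR : t ∈ Ioo (-(|t| + 1)) (|t| + 1) := ⟨by linarith [neg_abs_le t], by linarith [le_abs_self t]⟩
  have key : HasDerivAt (fun t => ∑' k, dysonTerm B (k + 1) t) (∑' k, B t * dysonTerm B k t) t := by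
    refine hasDerivAt_tsum_of_isPreconnected
      (g := fun k => dysonTerm B (k + 1)) (g' := fun k y => B y * dysonTerm B k y) (y₀ := t)
      (u := fun k => β * (‖(1 : 𝔸)‖ * ((β * (|t| + 1)) ^ k / k.factorial)))
      (t := Ioo (-(|t| + 1)) (|t| + 1))
      (((Real.summable_pow_div_factorial _).mul_left _).mul_left _) isOpen_Ioo isPreconnected_Ioo
      (fun k y _ => hasDerivAt_dysonTerm_succ hB k y) ?_ hR
      ((summable_nat_add_iff 1).2 (hsum t)) hR
    intro k y hy
    have hy' : |y| ≤ |t| + 1 := (abs_lt.2 hy).le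
    calc ‖B y * dysonTerm B k y‖ ≤ ‖B y‖ * ‖dysonTerm B k y‖ := norm_mul_le _ _
      _ ≤ β * (‖(1 : 𝔸)‖ * ((β * |y|) ^ k / k.factorial)) :=
          mul_le_mul (hβ y) (norm_dysonTerm_le hβ hB k y) (norm_nonneg _) hβ0
      _ ≤ _ := by gcongr
  rw [(hsum t).tsum_mul_left] at key
  have h := key.const_add 1
  rw [← hshift] at h
  exact h

theorem propagator_zero (B : ℝ → 𝔸) : propagator B 0 = 1 := by
  rw [propagator, tsum_eq_single 0]
  · rfl
  · intro k hk
    obtain ⟨k, rfl⟩ := Nat.exists_eq_succ_of_ne_zero hk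
    simp [dysonTerm]

end Propagator

/-! ### Unitarity of the propagator and Duhamel's formula. -/

section SkewAdjoint

variable {𝔸 : Type*} [CStarAlgebra 𝔸]

/-- A continuous bounded family of skew-adjoint elements. -/
structure IsSkewGenerator (B : ℝ → 𝔸) : Prop where
  continuous : Continuous B
  bounded : ∃ β : ℝ, ∀ t, ‖B t‖ ≤ β
  star_eq : ∀ t, star (B t) = -B t

theorem IsSkewGenerator.hasDerivAt {B : ℝ → 𝔸} (hB : IsSkewGenerator B) (t : ℝ) :
    HasDerivAt (propagator B) (B t * propagator B t) t :=
  let ⟨_, hβ⟩ := hB.bounded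
  hasDerivAt_propagator hβ hB.continuous t

theorem IsSkewGenerator.continuous_propagator {B : ℝ → 𝔸} (hB : IsSkewGenerator B) :
    Continuous (propagator B) :=
  continuous_iff_continuousAt.2 fun t => (hB.hasDerivAt t).continuousAt

/-- The interaction picture: equal generators yield unitarity, and integration over $[0,t]$ yields
Duhamel's formula. -/
theorem IsSkewGenerator.hasDerivAt_star_mul {B B' : ℝ → 𝔸} (hB : IsSkewGenerator B)
    (hB' : IsSkewGenerator B') (t : ℝ) :
    HasDerivAt (fun s => star (propagator B s) * propagator B' s)
      (star (propagator B t) * (B' t - B t) * propagator B' t) t := by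
  refine ((hB.hasDerivAt t).star.mul (hB'.hasDerivAt t)).congr_deriv ?_
  rw [star_mul, hB.star_eq]
  noncomm_ring

theorem IsSkewGenerator.star_mul_self {B : ℝ → 𝔸} (hB : IsSkewGenerator B) (t : ℝ) :
    star (propagator B t) * propagator B t = 1 := by
  have h := is_const_of_deriv_eq_zero
    (fun s => (hB.hasDerivAt_star_mul hB s).differentiableAt)
    (fun s => by rw [(hB.hasDerivAt_star_mul hB s).deriv]; simp) t 0
  simpa [propagator_zero] using h

/-- Duhamel's formula. -/
theorem IsSkewGenerator.duhamel {B B' : ℝ → 𝔸} (hB : IsSkewGenerator B)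
    (hB' : IsSkewGenerator B') (t : ℝ) :
    star (propagator B t) * propagator B' t = 1 +
      ∫ s in (0 : ℝ)..t, star (propagator B s) * (B' s - B s) * propagator B' s := by
  have hc : Continuous fun s => star (propagator B s) * (B' s - B s) * propagator B' s :=
    (hB.continuous_propagator.star.mul (hB'.continuous.sub hB.continuous)).mul
      hB'.continuous_propagator
  rw [intervalIntegral.integral_eq_sub_of_hasDerivAt
    (fun s _ => hB.hasDerivAt_star_mul hB' s) (hc.intervalIntegrable _ _)]
  simp [propagator_zero]

theorem norm_le_one_of_star_mul_self {U : 𝔸} (hU : star U * U = 1) : ‖U‖ ≤ 1 := by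
  rcases subsingleton_or_nontrivial 𝔸 with h | h
  · rw [Subsingleton.elim U 0, norm_zero]; exact zero_le_one
  · have := CStarRing.norm_star_mul_self (x := U)
    rw [hU, CStarRing.norm_one] at this
    nlinarith [norm_nonneg U]

theorem IsSkewGenerator.norm_propagator_le {B : ℝ → 𝔸} (hB : IsSkewGenerator B) (t : ℝ) :
    ‖propagator B t‖ ≤ 1 :=
  norm_le_one_of_star_mul_self (hB.star_mul_self t)

theorem IsSkewGenerator.norm_star_mul_sub_one_le {B B' : ℝ → 𝔸} (hB : IsSkewGenerator B)
    (hB' : IsSkewGenerator B') {δ : ℝ} (hδ : ∀ s, ‖B' s - B s‖ ≤ δ) (t : ℝ) :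
    ‖star (propagator B t) * propagator B' t - 1‖ ≤ δ * |t| := by
  rw [hB.duhamel hB' t, add_sub_cancel_left]
  refine (intervalIntegral.norm_integral_le_of_norm_le_const (C := δ) fun s _ => ?_).trans
    (by rw [sub_zero])
  have hδ0 := (norm_nonneg _).trans (hδ s)
  calc ‖star (propagator B s) * (B' s - B s) * propagator B' s‖
      ≤ ‖star (propagator B s)‖ * ‖B' s - B s‖ * ‖propagator B' s‖ :=
        (norm_mul_le _ _).trans (by gcongr; exact norm_mul_le _ _)
    _ ≤ 1 * δ * 1 := by
        gcongr
        · rw [norm_star]; exact hB.norm_propagator_le s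
        · exact hδ s
        · exact hB'.norm_propagator_le s
    _ = δ := by ring

end SkewAdjoint

/-! ### The logarithm of a determinant as a series of traces. -/

section MatrixTrace

open scoped Matrix.Norms.L2Operator

variable {n : Type*} [Fintype n] [DecidableEq n]

theorem norm_entry_le (A : Matrix n n ℂ) (i j : n) : ‖A i j‖ ≤ ‖A‖ := by
  have h := Matrix.l2_opNorm_mulVec A (EuclideanSpace.single j 1)
  rw [PiLp.norm_single, norm_one, mul_one] at h
  have h2 := (PiLp.norm_apply_le _ i).trans h
  simpa using h2

theorem norm_trace_le (A : Matrix n n ℂ) : ‖A.trace‖ ≤ Fintype.card n * ‖A‖ := by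
  calc ‖A.trace‖ ≤ ∑ i, ‖A i i‖ := norm_sum_le _ _
    _ ≤ ∑ _i : n, ‖A‖ := Finset.sum_le_sum fun i _ => norm_entry_le A i i
    _ = _ := by simp

/-- The trace as a continuous linear functional. -/
def traceCLM : Matrix n n ℂ →L[ℂ] ℂ :=
  LinearMap.mkContinuous (Matrix.traceLinearMap n ℂ ℂ) (Fintype.card n) norm_trace_le

theorem traceCLM_apply (A : Matrix n n ℂ) : traceCLM A = A.trace := rfl

theorem trace_star {n : Type*} [Fintype n] (A : Matrix n n ℂ) : (star A).trace = star A.trace :=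
  Matrix.trace_conjTranspose A

/-- The sum is $-\log(1-y)$: the term `m = 0` vanishes because `(0 : ℂ)⁻¹ = 0`. -/
theorem summable_inv_smul_pow {R : Type*} [NormedRing R] [NormOneClass R] [NormedAlgebra ℂ R]
    [CompleteSpace R] {y : R} (hy : ‖y‖ < 1) : Summable fun m : ℕ => (m : ℂ)⁻¹ • y ^ m := by
  refine Summable.of_norm_bounded (summable_geometric_of_lt_one (norm_nonneg y) hy) fun m => ?_
  rw [norm_smul, norm_inv, Complex.norm_natCast]
  calc (m : ℝ)⁻¹ * ‖y ^ m‖ ≤ 1 * ‖y‖ ^ m := by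
        gcongr
        · exact Nat.cast_inv_le_one m
        · exact norm_pow_le _ _
    _ = _ := one_mul _

theorem abs_im_neg_log_one_sub_le {w : ℂ} (hw : ‖w‖ < 1) :
    |(-Complex.log (1 - w)).im| ≤ Real.pi / 2 := by
  rw [Complex.neg_im, abs_neg, Complex.log_im, Complex.abs_arg_le_pi_div_two_iff]
  have := (Complex.re_le_norm w).trans hw.le
  simpa using this

/-- For a unitary matrix `U` and `|ρ| < 1`, the imaginary part of
`- log det (1 - ρ U) = ∑ tr (ρ U) ^ m / m` is at most `π / 2` for each eigenvalue. -/
theorem abs_im_tsum_trace_pow_le {U : Matrix n n ℂ} (hU : star U * U = 1) {ρ : ℂ} (hρ : ‖ρ‖ < 1) :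
    |(∑' m : ℕ, (m : ℂ)⁻¹ * ((ρ • U) ^ m).trace).im| ≤ Fintype.card n * (Real.pi / 2) := by
  rcases isEmpty_or_nonempty n with hn | hn
  · simp [Matrix.trace]
  have hU' : U * star U = 1 := mul_eq_one_comm.1 hU
  have hN : IsStarNormal U := ⟨by rw [Commute, SemiconjBy, hU, hU']⟩
  have hsp : ∀ x : spectrum ℂ U, ‖(x : ℂ)‖ ≤ 1 := fun x =>
    (spectrum.norm_le_norm_of_mem x.2).trans (norm_le_one_of_star_mul_self hU)
  set φ := cfcHom (R := ℂ) (a := U) hN with hφ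
  set ι : C(spectrum ℂ U, ℂ) := (ContinuousMap.id ℂ).restrict (spectrum ℂ U) with hι
  have hne : Nonempty (spectrum ℂ U) := (spectrum.nonempty U).to_subtype
  have hιn : ‖ρ • ι‖ < 1 := by
    rw [norm_smul]
    have : ‖ι‖ ≤ 1 := (ContinuousMap.norm_le _ zero_le_one).2 hsp
    nlinarith [norm_nonneg ρ]
  have hs := summable_inv_smul_pow hιn
  set f : C(spectrum ℂ U, ℂ) := ∑' m : ℕ, (m : ℂ)⁻¹ • (ρ • ι) ^ m with hf
  have hfx : ∀ x : spectrum ℂ U, f x = -Complex.log (1 - ρ * x) := by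
    intro x
    have hx : ‖ρ * x‖ < 1 := by
      rw [norm_mul]; nlinarith [norm_nonneg ρ, hsp x]
    have h1 := (hs.hasSum.map (ContinuousMap.evalCLM ℂ x) (ContinuousMap.evalCLM ℂ x).continuous)
    refine h1.unique ?_
    convert Complex.hasSum_taylorSeries_neg_log hx using 2 with m
    simp [hι, div_eq_inv_mul]
  have hφf : HasSum (fun m : ℕ => (m : ℂ)⁻¹ • (ρ • U) ^ m) (φ f) := by
    have h1 := hs.hasSum.map φ (cfcHom_continuous hN)
    convert h1 using 2 with m
    simp only [Function.comp, map_smul, map_pow]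
    rw [hφ, hι, cfcHom_id]
  have htr : ∑' m : ℕ, (m : ℂ)⁻¹ * ((ρ • U) ^ m).trace = (φ f).trace := by
    have h1 := hφf.map traceCLM traceCLM.continuous
    refine (h1.congr_fun fun m => ?_).tsum_eq
    simp [traceCLM_apply]
  -- Functional calculus replaces a count of eigenvalues: $f-\bar f=2i\,\mathrm{Im} f$ has sup norm
  -- at most $\pi$, star homomorphisms contract, and the trace costs a factor `Fintype.card n`.
  have hb : ‖φ f - star (φ f)‖ ≤ Real.pi := by
    rw [← map_star, ← map_sub]
    refine (NonUnitalStarAlgHom.norm_apply_le φ _).trans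
      ((ContinuousMap.norm_le _ Real.pi_pos.le).2 fun x => ?_)
    have hx : ‖ρ * x‖ < 1 := by
      rw [norm_mul]; nlinarith [norm_nonneg ρ, hsp x]
    have h1 : (f - star f) x = (2 * (f x).im : ℝ) * Complex.I := by
      simp only [ContinuousMap.sub_apply, ContinuousMap.star_apply]
      exact Complex.sub_conj (f x)
    rw [h1, norm_mul, Complex.norm_I, mul_one, Complex.norm_real, Real.norm_eq_abs, abs_mul,
      abs_two, hfx]
    linarith [abs_im_neg_log_one_sub_le hx]
  have h2 := (norm_trace_le (φ f - star (φ f))).trans (mul_le_mul_of_nonneg_left hb (by positivity))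
  have h3 : (φ f - star (φ f)).trace = (2 * (φ f).trace.im : ℝ) * Complex.I := by
    rw [Matrix.trace_sub, trace_star]
    exact Complex.sub_conj _
  rw [h3, norm_mul, Complex.norm_I, mul_one, Complex.norm_real, Real.norm_eq_abs, abs_mul,
    abs_two] at h2
  rw [htr]
  linarith

/-- `Y` and `Y'` need not commute, so the derivative `D` of the power is described only through its
traces against powers of `Y t`, where cyclicity applies. The free exponent `k` carries the
induction. -/
theorem exists_hasDerivAt_pow {Y : ℝ → Matrix n n ℂ} {Y' : Matrix n n ℂ} {t : ℝ}
    (hY : HasDerivAt Y Y' t) (m : ℕ) : ∃ D, HasDerivAt (fun s => Y s ^ m) D t ∧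
      ∀ k, (D * Y t ^ (k + 1)).trace = m * (Y t ^ (m + k) * Y').trace := by
  induction m with
  | zero => exact ⟨0, by simpa using! hasDerivAt_const t (1 : Matrix n n ℂ), by simp⟩
  | succ m ih =>
    obtain ⟨D, hD, h⟩ := ih
    refine ⟨D * Y t + Y t ^ m * Y', by simpa only [pow_succ] using! hD.mul hY, fun k => ?_⟩
    have e1 : (Y t ^ m * Y' * Y t ^ (k + 1)).trace = (Y t ^ (m + 1 + k) * Y').trace := by
      rw [Matrix.trace_mul_comm, ← mul_assoc, ← pow_add]
      congr 3; omega
    rw [add_mul, Matrix.trace_add, mul_assoc D, ← pow_succ', h, e1, ← add_assoc, add_right_comm m k 1]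
    push_cast
    ring

theorem hasDerivAt_trace_pow {Y : ℝ → Matrix n n ℂ} {Y' : Matrix n n ℂ} {t : ℝ}
    (hY : HasDerivAt Y Y' t) (m : ℕ) :
    HasDerivAt (fun s => (Y s ^ (m + 1)).trace) ((m + 1) * (Y t ^ m * Y').trace) t := by
  obtain ⟨D, hD, h⟩ := exists_hasDerivAt_pow hY m
  have h1 := (traceCLM.restrictScalars ℝ).hasFDerivAt.comp_hasDerivAt t (hD.mul hY)
  refine (h1.congr_deriv ?_).congr_of_eventuallyEq (Filter.Eventually.of_forall fun s => ?_)
  · have h0 := h 0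
    simp only [zero_add, pow_one, add_zero] at h0
    change (D * Y t + Y t ^ m * Y').trace = _
    rw [Matrix.trace_add, h0]
    ring
  · simp only [pow_succ]; rfl

/-- Termwise differentiation of `- log det (1 - Y)`. -/
theorem hasDerivAt_tsum_trace_pow {Y Y' : ℝ → Matrix n n ℂ} (hY : ∀ t, HasDerivAt Y (Y' t) t)
    {r K : ℝ} (hr : r < 1) (hYr : ∀ t, ‖Y t‖ ≤ r) (hK : ∀ t, ‖Y' t‖ ≤ K) (t : ℝ) :
    HasDerivAt (fun s => ∑' m : ℕ, (m : ℂ)⁻¹ * (Y s ^ m).trace)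
      (((∑' m : ℕ, Y t ^ m) * Y' t).trace) t := by
  have hr0 : 0 ≤ r := (norm_nonneg _).trans (hYr 0)
  rcases isEmpty_or_nonempty n with hn | hn
  · simpa [Matrix.trace] using hasDerivAt_const t (0 : ℂ)
  have hsum : ∀ s, Summable fun m : ℕ => (m : ℂ)⁻¹ * (Y s ^ m).trace := fun s => by
    have := (summable_inv_smul_pow ((hYr s).trans_lt hr)).map traceCLM traceCLM.continuous
    refine this.congr fun m => ?_
    simp [traceCLM_apply]
  -- Dropping the zero term lets the weight $1/(m+1)$ cancel the factor $m+1$ from differentiating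
  -- the power.
  have hshift : (fun s => ∑' m : ℕ, (m : ℂ)⁻¹ * (Y s ^ m).trace) =
      fun s => ∑' m : ℕ, ((m + 1 : ℕ) : ℂ)⁻¹ * (Y s ^ (m + 1)).trace := by
    funext s
    rw [(hsum s).tsum_eq_zero_add]
    simp
  have hgeom := (summable_geometric_of_norm_lt_one (x := Y t) ((hYr t).trans_lt hr)).hasSum
  have hval : ((∑' m : ℕ, Y t ^ m) * Y' t).trace = ∑' m : ℕ, (Y t ^ m * Y' t).trace :=
    (((hgeom.mul_right (Y' t)).map traceCLM traceCLM.continuous).tsum_eq).symm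
  rw [hshift, hval]
  refine hasDerivAt_tsum (y₀ := t) (u := fun m => Fintype.card n * (r ^ m * K))
    (g := fun m s => ((m + 1 : ℕ) : ℂ)⁻¹ * (Y s ^ (m + 1)).trace)
    (g' := fun m s => (Y s ^ m * Y' s).trace)
    (((summable_geometric_of_lt_one hr0 hr).mul_right K).mul_left _) (fun m s => ?_) (fun m s => ?_)
    ((summable_nat_add_iff 1).2 (hsum t)) t
  · refine ((hasDerivAt_trace_pow (hY s) m).const_mul _).congr_deriv ?_
    rw [← mul_assoc, Nat.cast_succ, inv_mul_cancel₀ (Nat.cast_add_one_ne_zero m), one_mul]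
  · refine (norm_trace_le _).trans ?_
    gcongr
    calc ‖Y s ^ m * Y' s‖ ≤ ‖Y s ^ m‖ * ‖Y' s‖ := norm_mul_le _ _
      _ ≤ r ^ m * K := by
        gcongr
        · exact (norm_pow_le _ _).trans (pow_le_pow_left₀ (norm_nonneg _) (hYr s) m)
        · exact hK s

end MatrixTrace

/-! ### The monodromy matrix and its dependence on the potential. -/

section Monodromy

open scoped Matrix.Norms.L2Operator

variable {n : Type*} [Fintype n] [DecidableEq n]

/-- The real diagonal matrix with entries `v`. -/
def realDiag {n : Type*} [DecidableEq n] (v : n → ℝ) : Matrix n n ℂ := Matrix.diagonal fun i => (v i : ℂ)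

theorem star_realDiag {n : Type*} [DecidableEq n] (v : n → ℝ) : star (realDiag v) = realDiag v := by
  rw [realDiag, Matrix.star_eq_conjTranspose, Matrix.diagonal_conjTranspose]
  congr 1
  funext i
  exact Complex.conj_ofReal _

theorem norm_realDiag_le (v : n → ℝ) : ‖realDiag v‖ ≤ ‖v‖ := by
  rw [realDiag, Matrix.l2_opNorm_diagonal]
  exact (pi_norm_le_iff_of_nonneg (norm_nonneg v)).2 fun i => by
    rw [Complex.norm_real]; exact norm_le_pi_norm v i

theorem realDiag_sub {n : Type*} [DecidableEq n] (v w : n → ℝ) : realDiag (v - w) = realDiag v - realDiag w := by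
  simp [realDiag, Matrix.diagonal_sub]

/-- The generator `- i (G + a diag v)`, for a family of matrices `G`. -/
def generator {n : Type*} [DecidableEq n] (G : ℝ → Matrix n n ℂ) (a : ℝ) (v : n → ℝ) (θ : ℝ) : Matrix n n ℂ :=
  -(Complex.I • (G θ + (a : ℂ) • realDiag v))

/-- A continuous bounded family of Hermitian matrices. -/
structure IsHermitianFamily (G : ℝ → Matrix n n ℂ) : Prop where
  continuous : Continuous G
  bounded : ∃ β : ℝ, ∀ t, ‖G t‖ ≤ β
  star_eq : ∀ t, star (G t) = G t

variable {G : ℝ → Matrix n n ℂ}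

theorem IsHermitianFamily.isSkewGenerator (hG : IsHermitianFamily G) (a : ℝ) (v : n → ℝ) :
    IsSkewGenerator (generator G a v) where
  continuous := by
    have h := hG.continuous.add (continuous_const (y := (a : ℂ) • realDiag v))
    exact (h.const_smul Complex.I).neg
  bounded := by
    obtain ⟨β, hβ⟩ := hG.bounded
    refine ⟨β + ‖(a : ℂ) • realDiag v‖, fun t => ?_⟩
    rw [generator, norm_neg, norm_smul, Complex.norm_I, one_mul]
    exact (norm_add_le _ _).trans (by gcongr; exact hβ t)
  star_eq t := by
    rw [generator, star_neg, star_smul, star_add, star_smul, hG.star_eq, star_realDiag]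
    simp [add_comm]

theorem generator_sub {n : Type*} [DecidableEq n] (G : ℝ → Matrix n n ℂ) (a : ℝ) (v w : n → ℝ) (θ : ℝ) :
    generator G a v θ - generator G a w θ = -((Complex.I * a) • realDiag (v - w)) := by
  simp only [generator, realDiag_sub, smul_add, smul_sub, mul_smul]
  abel

/-- The solution `X` of `X' = - i (G + a diag v) X`, `X 0 = 1`. -/
def flow (G : ℝ → Matrix n n ℂ) (a : ℝ) (v : n → ℝ) : ℝ → Matrix n n ℂ :=
  propagator (generator G a v)

/-- The monodromy matrix over one period. -/
def monodromy (G : ℝ → Matrix n n ℂ) (a : ℝ) (v : n → ℝ) : Matrix n n ℂ := flow G a v 1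

theorem IsHermitianFamily.star_mul_flow (hG : IsHermitianFamily G) (a : ℝ) (v : n → ℝ) (t : ℝ) :
    star (flow G a v t) * flow G a v t = 1 :=
  (hG.isSkewGenerator a v).star_mul_self t

theorem IsHermitianFamily.flow_mul_star (hG : IsHermitianFamily G) (a : ℝ) (v : n → ℝ) (t : ℝ) :
    flow G a v t * star (flow G a v t) = 1 :=
  mul_eq_one_comm.1 (hG.star_mul_flow a v t)

theorem IsHermitianFamily.norm_flow_le (hG : IsHermitianFamily G) (a : ℝ) (v : n → ℝ) (t : ℝ) :
    ‖flow G a v t‖ ≤ 1 :=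
  (hG.isSkewGenerator a v).norm_propagator_le t

theorem IsHermitianFamily.norm_flow_sub_le (hG : IsHermitianFamily G) (a : ℝ) (v w : n → ℝ)
    (t : ℝ) : ‖flow G a v t - flow G a w t‖ ≤ |a| * |t| * ‖v - w‖ := by
  have h := (hG.isSkewGenerator a w).norm_star_mul_sub_one_le (hG.isSkewGenerator a v)
    (δ := |a| * ‖v - w‖) (fun s => by
      rw [generator_sub G, norm_neg, norm_smul, norm_mul, Complex.norm_I, one_mul, Complex.norm_real]
      exact mul_le_mul_of_nonneg_left (norm_realDiag_le _) (norm_nonneg _)) t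
  have e : flow G a v t - flow G a w t =
      flow G a w t * (star (flow G a w t) * flow G a v t - 1) := by
    rw [mul_sub, ← mul_assoc, hG.flow_mul_star, one_mul, mul_one]
  rw [e]
  calc _ ≤ ‖flow G a w t‖ * ‖star (flow G a w t) * flow G a v t - 1‖ := norm_mul_le _ _
    _ ≤ 1 * (|a| * ‖v - w‖ * |t|) :=
      mul_le_mul (hG.norm_flow_le a w t) h (norm_nonneg _) zero_le_one
    _ = _ := by ring

theorem IsHermitianFamily.continuous_flow_left (hG : IsHermitianFamily G) (a t : ℝ) :
    Continuous fun v => flow G a v t := by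
  refine (LipschitzWith.of_dist_le_mul (K := ⟨|a| * |t|, by positivity⟩) fun v w => ?_).continuous
  rw [dist_eq_norm, dist_eq_norm]
  exact hG.norm_flow_sub_le a v w t

theorem IsHermitianFamily.continuous_flow_right (hG : IsHermitianFamily G) (a : ℝ) (v : n → ℝ) :
    Continuous (flow G a v) :=
  (hG.isSkewGenerator a v).continuous_propagator

theorem IsHermitianFamily.continuous_flow (hG : IsHermitianFamily G) (a : ℝ) :
    Continuous fun p : (n → ℝ) × ℝ => flow G a p.1 p.2 := by
  rw [continuous_iff_continuousAt]
  rintro ⟨v, t⟩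
  rw [ContinuousAt, tendsto_iff_norm_sub_tendsto_zero]
  have h1 : Filter.Tendsto (fun p : (n → ℝ) × ℝ => |a| * |p.2| * ‖p.1 - v‖ +
      ‖flow G a v p.2 - flow G a v t‖) (nhds (v, t)) (nhds 0) := by
    have hc : Continuous fun p : (n → ℝ) × ℝ => |a| * |p.2| * ‖p.1 - v‖ +
        ‖flow G a v p.2 - flow G a v t‖ := by
      have := hG.continuous_flow_right a v
      fun_prop
    simpa using hc.tendsto (v, t)
  refine squeeze_zero (fun _ => norm_nonneg _) (fun p => ?_) h1
  calc ‖flow G a p.1 p.2 - flow G a v t‖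
      ≤ ‖flow G a p.1 p.2 - flow G a v p.2‖ + ‖flow G a v p.2 - flow G a v t‖ :=
        norm_sub_le_norm_sub_add_norm_sub _ _ _
    _ ≤ _ := by gcongr; exact hG.norm_flow_sub_le a p.1 v p.2

/-- The averaged occupation matrix `∫₀¹ X* P_j X dθ` of the site `j`. -/
def occupation (G : ℝ → Matrix n n ℂ) (a : ℝ) (v : n → ℝ) (j : n) : Matrix n n ℂ :=
  ∫ θ in (0 : ℝ)..1, star (flow G a v θ) * realDiag (Pi.single j 1) * flow G a v θ

theorem IsHermitianFamily.continuous_occupation_integrand (hG : IsHermitianFamily G) (a : ℝ)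
    (v : n → ℝ) (j : n) : Continuous fun θ =>
      star (flow G a v θ) * realDiag (Pi.single j 1) * flow G a v θ := by
  have := hG.continuous_flow_right a v
  fun_prop

theorem IsHermitianFamily.continuous_occupation (hG : IsHermitianFamily G) (a : ℝ) (j : n) :
    Continuous fun v => occupation G a v j := by
  refine intervalIntegral.continuous_parametric_intervalIntegral_of_continuous' ?_ 0 1
  have := hG.continuous_flow a
  simp only [Function.uncurry_def]
  fun_prop

theorem IsHermitianFamily.sum_occupation (hG : IsHermitianFamily G) (a : ℝ) (v : n → ℝ) :
    ∑ j, occupation G a v j = 1 := by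
  simp only [occupation]
  rw [← intervalIntegral.integral_finsetSum fun j _ =>
    (hG.continuous_occupation_integrand a v j).intervalIntegrable _ _]
  have hP : ∑ j : n, realDiag (Pi.single j (1 : ℝ)) = (1 : Matrix n n ℂ) := by
    ext i k
    simp only [realDiag, Matrix.sum_apply, Matrix.diagonal_apply, Matrix.one_apply]
    split_ifs with h
    · simp [Pi.single_apply, apply_ite Complex.ofReal]
    · simp
  simp only [← Finset.sum_mul, ← Finset.mul_sum, hP, mul_one, hG.star_mul_flow]
  simp

theorem IsHermitianFamily.trace_occupation (hG : IsHermitianFamily G) (a : ℝ) (v : n → ℝ) (j : n) :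
    (occupation G a v j).trace = 1 := by
  rw [← traceCLM_apply, occupation, ← ContinuousLinearMap.intervalIntegral_comp_comm _
    ((hG.continuous_occupation_integrand a v j).intervalIntegrable _ _)]
  have h : ∀ θ, traceCLM (star (flow G a v θ) * realDiag (Pi.single j 1) * flow G a v θ) = 1 := by
    intro θ
    rw [traceCLM_apply, Matrix.trace_mul_comm, ← mul_assoc, hG.flow_mul_star, one_mul, realDiag,
      Matrix.trace_diagonal]
    simp [Pi.single_apply, apply_ite Complex.ofReal]
  simp [h]

theorem IsHermitianFamily.norm_occupation_le (hG : IsHermitianFamily G) (a : ℝ) (v : n → ℝ)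
    (j : n) : ‖occupation G a v j‖ ≤ 1 := by
  refine (intervalIntegral.norm_integral_le_of_norm_le_const (C := 1) fun θ _ => ?_).trans (by simp)
  calc ‖star (flow G a v θ) * realDiag (Pi.single j 1) * flow G a v θ‖
      ≤ ‖star (flow G a v θ)‖ * ‖realDiag (Pi.single j (1 : ℝ))‖ * ‖flow G a v θ‖ :=
        (norm_mul_le _ _).trans (by gcongr; exact norm_mul_le _ _)
    _ ≤ 1 * 1 * 1 := by
        gcongr
        · rw [norm_star]; exact hG.norm_flow_le a v θ
        · exact (norm_realDiag_le _).trans (by rw [Pi.norm_single, norm_one])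
        · exact hG.norm_flow_le a v θ
    _ = 1 := by norm_num

/-- The derivative of the monodromy matrix in the potential at one site. -/
theorem IsHermitianFamily.hasDerivAt_monodromy (hG : IsHermitianFamily G) (a : ℝ) (v : n → ℝ)
    (j : n) (t : ℝ) :
    HasDerivAt (fun s => monodromy G a (Function.update v j s))
      (-((Complex.I * a) • (monodromy G a (Function.update v j t) *
        occupation G a (Function.update v j t) j))) t := by
  set u := Function.update v j with hu
  have huc : Continuous u := continuous_const.update j continuous_id
  let R : ℝ → Matrix n n ℂ := fun s =>
    ∫ θ in (0 : ℝ)..1, star (flow G a (u t) θ) * realDiag (Pi.single j 1) * flow G a (u s) θ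
  have hR : Continuous R := by
    refine intervalIntegral.continuous_parametric_intervalIntegral_of_continuous' ?_ 0 1
    have h1 := hG.continuous_flow_right a (u t)
    have h2 : Continuous fun p : ℝ × ℝ => flow G a (u p.1) p.2 :=
      Continuous.comp (g := fun p : (n → ℝ) × ℝ => flow G a p.1 p.2)
        (f := fun p : ℝ × ℝ => (u p.1, p.2)) (hG.continuous_flow a)
        ((huc.comp continuous_fst).prodMk continuous_snd)
    simp only [Function.uncurry_def]
    fun_prop
  have hdiff : ∀ s, u s - u t = (s - t) • Pi.single j (1 : ℝ) := by
    intro s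
    funext i
    by_cases h : i = j
    · subst h; simp [hu]
    · simp [hu, h]
  have hdiag : ∀ s, realDiag (u s - u t) = (s - t) • realDiag (Pi.single j (1 : ℝ)) := by
    intro s
    rw [hdiff]
    ext i k
    simp only [realDiag, Matrix.diagonal_apply, Matrix.smul_apply]
    split_ifs <;> simp
  -- Duhamel's formula makes the difference quotient exact, with `R s` having one flow frozen at
  -- `t`. Continuity of `R` then gives the derivative, since `R t` is the occupation matrix.
  have key : ∀ s, monodromy G a (u s) - monodromy G a (u t) =
      (s - t) • (-((Complex.I * a) • (monodromy G a (u t) * R s))) := by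
    intro s
    have h := (hG.isSkewGenerator a (u t)).duhamel (hG.isSkewGenerator a (u s)) 1
    have e : ∀ θ, star (propagator (generator G a (u t)) θ) *
        (generator G a (u s) θ - generator G a (u t) θ) * propagator (generator G a (u s)) θ =
        (-((Complex.I * a) * ((s - t : ℝ) : ℂ))) •
          (star (flow G a (u t) θ) * realDiag (Pi.single j 1) * flow G a (u s) θ) := by
      intro θ
      rw [generator_sub G, hdiag, ← Complex.coe_smul, smul_smul, ← neg_smul, mul_smul_comm,
        smul_mul_assoc]
      rfl
    simp only [e] at h
    rw [intervalIntegral.integral_smul] at h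
    change star (monodromy G a (u t)) * monodromy G a (u s) = 1 + _ • R s at h
    have h2 := congrArg (fun M => monodromy G a (u t) * M) h
    simp only [mul_add, mul_one, ← mul_assoc] at h2
    rw [show monodromy G a (u t) * star (monodromy G a (u t)) = 1 from hG.flow_mul_star a (u t) 1,
      one_mul] at h2
    rw [h2, add_sub_cancel_left, mul_smul_comm, ← Complex.coe_smul, ← neg_smul, smul_smul]
    congr 1
    ring
  rw [hasDerivAt_iff_tendsto_slope]
  have hlim : Filter.Tendsto (fun s => -((Complex.I * a) • (monodromy G a (u t) * R s)))
      (nhdsWithin t {t}ᶜ) (nhds (-((Complex.I * a) • (monodromy G a (u t) *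
        occupation G a (u t) j)))) := by
    have hc : Continuous fun s => -((Complex.I * a) • (monodromy G a (u t) * R s)) := by fun_prop
    exact (hc.tendsto t).mono_left nhdsWithin_le_nhds
  refine hlim.congr' ?_
  filter_upwards [self_mem_nhdsWithin] with s hs
  rw [slope, vsub_eq_sub, key, smul_smul, inv_mul_cancel₀ (sub_ne_zero.2 hs), one_smul]

end Monodromy

/-! ### Poisson kernel of the monodromy matrix and spectral averaging. -/

section SpectralDensity

open scoped Matrix.Norms.L2Operator

variable {n : Type*} [Fintype n] [DecidableEq n]

theorem re_trace_star_mul_self {n : Type*} [Fintype n] (A : Matrix n n ℂ) :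
    (star A * A).trace.re = ∑ j, ∑ i, ‖A i j‖ ^ 2 := by
  simp only [Matrix.trace, Matrix.diag_apply, Matrix.mul_apply, Matrix.star_apply, Complex.re_sum]
  refine Finset.sum_congr rfl fun j _ => Finset.sum_congr rfl fun i _ => ?_
  rw [← Complex.normSq_eq_norm_sq, Complex.star_def, ← Complex.normSq_eq_conj_mul_self,
    Complex.ofReal_re]

/-- The Neumann series of `(1 - Y)⁻¹`. -/
def neumann (Y : Matrix n n ℂ) : Matrix n n ℂ := ∑' k : ℕ, Y ^ k

theorem continuous_neumann {X : Type*} [TopologicalSpace X] {f : X → Matrix n n ℂ}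
    (hf : Continuous f) {r : ℝ} (hr : r < 1) (h : ∀ x, ‖f x‖ ≤ r) :
    Continuous fun x => neumann (f x) := by
  rcases isEmpty_or_nonempty n with hn | hn
  · exact continuous_of_const fun _ _ => Subsingleton.elim _ _
  rcases isEmpty_or_nonempty X with hX | ⟨⟨x⟩⟩
  · exact continuous_of_const fun x => hX.elim x
  have hb : ∀ k x, ‖f x ^ k‖ ≤ r ^ k := fun k x => (norm_pow_le _ _).trans
    (pow_le_pow_left₀ (norm_nonneg _) (h x) k)
  exact continuous_tsum (fun k => hf.pow k)
    (summable_geometric_of_lt_one ((norm_nonneg _).trans (h x)) hr) hb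

/-- With $Y=\rho U$ and $S=(1-Y)^{-1}$ one has $YS=S-1$ and $Y^*Y=|\rho|^2$, so
$|\rho|^2S^*S=(S-1)^*(S-1)$. This is the Poisson kernel identity for the real part of the Cayley
transform $2S-1$. -/
theorem neumann_add_star {U : Matrix n n ℂ} (hU : star U * U = 1) {ρ : ℂ} (hρ : ‖ρ‖ < 1) :
    neumann (ρ • U) + star (neumann (ρ • U)) - 1 =
      ((1 - ‖ρ‖ ^ 2 : ℝ) : ℂ) • (star (neumann (ρ • U)) * neumann (ρ • U)) := by
  have hY : ‖ρ • U‖ < 1 := by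
    rw [norm_smul]
    nlinarith [norm_nonneg ρ, norm_le_one_of_star_mul_self hU]
  set Y := ρ • U with hYd
  set S := neumann Y with hS
  have h1 : Y * S = S - 1 := by
    have : (1 - Y) * S = 1 := mul_neg_geom_series Y hY
    rw [sub_mul, one_mul] at this
    rw [← this]; abel
  have h2 : star S * star Y = star S - 1 := by
    rw [← star_mul, h1, star_sub, star_one]
  have h3 : star Y * Y = ((‖ρ‖ ^ 2 : ℝ) : ℂ) • (1 : Matrix n n ℂ) := by
    rw [hYd, star_smul, smul_mul_smul_comm, hU, Complex.star_def, ← Complex.normSq_eq_conj_mul_self,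
      Complex.normSq_eq_norm_sq]
  have h4 : ((‖ρ‖ ^ 2 : ℝ) : ℂ) • (star S * S) = (star S - 1) * (S - 1) := by
    rw [← h1, ← h2, mul_assoc, ← mul_assoc (star Y), h3, smul_mul_assoc, one_mul, mul_smul_comm]
  rw [Complex.ofReal_sub, sub_smul, h4, Complex.ofReal_one, one_smul]
  noncomm_ring

theorem re_trace_cayley_mul {U : Matrix n n ℂ} (hU : star U * U = 1) {ρ : ℂ} (hρ : ‖ρ‖ < 1)
    (Z : Matrix n n ℂ) :
    (((2 : ℂ) • neumann (ρ • U) - 1) * (star Z * Z)).trace.re =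
      (1 - ‖ρ‖ ^ 2) * (star (neumann (ρ • U) * star Z) * (neumann (ρ • U) * star Z)).trace.re := by
  have h := neumann_add_star hU hρ
  set S := neumann (ρ • U) with hS
  have h1 : (((2 : ℂ) • star S - 1) * (star Z * Z)).trace =
      star (((2 : ℂ) • S - 1) * (star Z * Z)).trace := by
    rw [← trace_star, star_mul, star_mul, star_star, Matrix.trace_mul_comm (star Z * Z)]
    simp
  have h2 : (star (S * star Z) * (S * star Z)).trace = (star S * S * (star Z * Z)).trace := by
    rw [star_mul, star_star, mul_assoc, Matrix.trace_mul_comm Z]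
    simp only [mul_assoc]
  have h3 : (((2 : ℂ) • S - 1) * (star Z * Z)).trace + (((2 : ℂ) • star S - 1) * (star Z * Z)).trace =
      2 * (((1 - ‖ρ‖ ^ 2 : ℝ) : ℂ) * (star (S * star Z) * (S * star Z)).trace) := by
    rw [h2, ← smul_eq_mul (2 : ℂ), ← smul_eq_mul _ (Matrix.trace _), ← Matrix.trace_smul,
      ← smul_mul_assoc, ← h, ← Matrix.trace_add, ← Matrix.trace_smul]
    congr 1
    rw [← smul_mul_assoc, ← add_mul]
    congr 1
    simp only [two_smul]
    abel
  have h4 := congrArg Complex.re h3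
  rw [h1, Complex.add_re, Complex.star_def, Complex.conj_re] at h4
  rw [show (2 : ℂ) = ((2 : ℝ) : ℂ) by simp, Complex.re_ofReal_mul, Complex.re_ofReal_mul] at h4
  simp only [Complex.ofReal_ofNat] at h4
  linarith

theorem re_trace_cayley_mul_nonneg {U : Matrix n n ℂ} (hU : star U * U = 1) {ρ : ℂ} (hρ : ‖ρ‖ < 1)
    (Z : Matrix n n ℂ) :
    0 ≤ (((2 : ℂ) • neumann (ρ • U) - 1) * (star Z * Z)).trace.re := by
  rw [re_trace_cayley_mul hU hρ, re_trace_star_mul_self]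
  have : 0 ≤ 1 - ‖ρ‖ ^ 2 := by nlinarith [norm_nonneg ρ]
  positivity

/-- The Poisson kernel of the monodromy matrix, weighted by the occupation of the site `j`. -/
def poissonDensity (G : ℝ → Matrix n n ℂ) (a : ℝ) (ρ : ℂ) (v : n → ℝ) (j : n) : ℝ :=
  (((2 : ℂ) • neumann (ρ • monodromy G a v) - 1) * occupation G a v j).trace.re

variable {G : ℝ → Matrix n n ℂ}

theorem IsHermitianFamily.norm_smul_monodromy_le (hG : IsHermitianFamily G) (a : ℝ) (ρ : ℂ)
    (v : n → ℝ) : ‖ρ • monodromy G a v‖ ≤ ‖ρ‖ := by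
  rw [norm_smul]
  exact mul_le_of_le_one_right (norm_nonneg _) (hG.norm_flow_le a v 1)

theorem IsHermitianFamily.continuous_poissonDensity (hG : IsHermitianFamily G) (a : ℝ) {ρ : ℂ}
    (hρ : ‖ρ‖ < 1) (j : n) : Continuous fun v => poissonDensity G a ρ v j := by
  have h1 : Continuous fun v => neumann (ρ • monodromy G a v) :=
    continuous_neumann ((hG.continuous_flow_left a 1).const_smul ρ) hρ
      fun v => hG.norm_smul_monodromy_le a ρ v
  have h2 : Continuous fun v => ((2 : ℂ) • neumann (ρ • monodromy G a v) - 1) * occupation G a v j := by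
    have h3 : Continuous fun v => (2 : ℂ) • neumann (ρ • monodromy G a v) := h1.const_smul (2 : ℂ)
    have h4 : Continuous fun v => (2 : ℂ) • neumann (ρ • monodromy G a v) - 1 :=
      h3.sub (continuous_const (y := (1 : Matrix n n ℂ)))
    exact h4.mul (hG.continuous_occupation a j)
  exact Complex.continuous_re.comp (traceCLM.continuous.comp h2)

/-- The occupation matrix is an average of $Z^*Z$ with $Z=P_jX(\theta)$, and the density is linear
in it. -/
theorem IsHermitianFamily.poissonDensity_nonneg (hG : IsHermitianFamily G) (a : ℝ) {ρ : ℂ}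
    (hρ : ‖ρ‖ < 1) (v : n → ℝ) (j : n) : 0 ≤ poissonDensity G a ρ v j := by
  set T := (2 : ℂ) • neumann (ρ • monodromy G a v) - 1 with hT
  let ℓ : Matrix n n ℂ →L[ℝ] ℝ := Complex.reCLM.comp
    ((traceCLM.comp (ContinuousLinearMap.mul ℂ (Matrix n n ℂ) T)).restrictScalars ℝ)
  have h : poissonDensity G a ρ v j = ℓ (occupation G a v j) := rfl
  rw [h, occupation, ← ContinuousLinearMap.intervalIntegral_comp_comm _
    ((hG.continuous_occupation_integrand a v j).intervalIntegrable _ _)]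
  refine intervalIntegral.integral_nonneg zero_le_one fun θ _ => ?_
  have hP : realDiag (Pi.single j (1 : ℝ)) * realDiag (Pi.single j (1 : ℝ)) =
      (realDiag (Pi.single j (1 : ℝ)) : Matrix n n ℂ) := by
    rw [realDiag, Matrix.diagonal_mul_diagonal]
    congr 1
    funext i
    by_cases hij : i = j
    · subst hij; simp
    · simp [hij]
  have e : star (flow G a v θ) * realDiag (Pi.single j 1) * flow G a v θ =
      star (realDiag (Pi.single j 1) * flow G a v θ) *
        (realDiag (Pi.single j 1) * flow G a v θ) := by
    rw [star_mul, star_realDiag, ← mul_assoc, mul_assoc (star _) _ (realDiag _), hP]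
  rw [e]
  exact re_trace_cayley_mul_nonneg (hG.star_mul_flow a v 1) hρ _

/-- If the monodromy matrix has the eigenvalue `μ`, the total Poisson density is large. -/
theorem IsHermitianFamily.le_sum_poissonDensity (hG : IsHermitianFamily G) (a : ℝ) {ρ : ℂ}
    (hρ : ‖ρ‖ < 1) (v : n → ℝ) {c : n → ℂ} (hc : c ≠ 0) {μ : ℂ}
    (hμ : (monodromy G a v).mulVec c = μ • c) :
    1 - ‖ρ‖ ^ 2 ≤ ‖1 - ρ * μ‖ ^ 2 * ∑ j, poissonDensity G a ρ v j := by
  have hU := hG.star_mul_flow a v 1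
  have hsum : ∑ j, poissonDensity G a ρ v j =
      (1 - ‖ρ‖ ^ 2) * ∑ j, ∑ i, ‖neumann (ρ • monodromy G a v) i j‖ ^ 2 := by
    have h := re_trace_cayley_mul hU hρ 1
    simp only [star_one, mul_one] at h
    rw [re_trace_star_mul_self] at h
    change _ = (1 - ‖ρ‖ ^ 2) * ∑ j, ∑ i, ‖neumann (ρ • flow G a v 1) i j‖ ^ 2
    rw [← h]
    simp only [poissonDensity]
    rw [← Complex.re_sum, ← Matrix.trace_sum, ← Finset.mul_sum, hG.sum_occupation, mul_one]
    rfl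
  set S := neumann (ρ • monodromy G a v) with hS
  have hinv : S * (1 - ρ • monodromy G a v) = 1 :=
    geom_series_mul_neg _ ((hG.norm_smul_monodromy_le a ρ v).trans_lt hρ)
  -- An eigenvector of $U$ is one of $S$, with eigenvalue $(1-\rho\mu)^{-1}$. Its modulus is bounded
  -- by the Hilbert–Schmidt norm of $S$, so no diagonalization is needed.
  have hSc : (1 - ρ * μ) • S.mulVec c = c := by
    have h := congrArg (fun M => M.mulVec c) hinv
    simp only [← Matrix.mulVec_mulVec, Matrix.sub_mulVec, Matrix.one_mulVec, Matrix.smul_mulVec, hμ]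
      at h
    rw [← Matrix.mulVec_smul, sub_smul, one_smul, mul_smul]
    exact h
  have hcs : ∑ i, ‖S.mulVec c i‖ ^ 2 ≤ (∑ j, ∑ i, ‖S i j‖ ^ 2) * ∑ j, ‖c j‖ ^ 2 := by
    rw [Finset.sum_comm, Finset.sum_mul]
    refine Finset.sum_le_sum fun i _ => ?_
    calc ‖S.mulVec c i‖ ^ 2 ≤ (∑ j, ‖S i j‖ * ‖c j‖) ^ 2 := by
          gcongr
          exact (norm_sum_le _ _).trans_eq (by simp only [norm_mul])
      _ ≤ _ := Finset.sum_mul_sq_le_sq_mul_sq _ _ _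
  have hcpos : 0 < ∑ j, ‖c j‖ ^ 2 := by
    obtain ⟨j, hj⟩ := Function.ne_iff.1 hc
    exact Finset.sum_pos' (fun _ _ => by positivity)
      ⟨j, Finset.mem_univ j, by have := norm_pos_iff.2 hj; positivity⟩
  have heq : ∑ j, ‖c j‖ ^ 2 = ‖1 - ρ * μ‖ ^ 2 * ∑ i, ‖S.mulVec c i‖ ^ 2 := by
    conv_lhs => rw [← hSc]
    rw [Finset.mul_sum]
    exact Finset.sum_congr rfl fun i _ => by rw [Pi.smul_apply, norm_smul, mul_pow]
  have hr : 0 ≤ 1 - ‖ρ‖ ^ 2 := by nlinarith [norm_nonneg ρ]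
  have h1 : 1 ≤ ‖1 - ρ * μ‖ ^ 2 * ∑ j, ∑ i, ‖S i j‖ ^ 2 := by
    refine le_of_mul_le_mul_right ?_ hcpos
    calc 1 * ∑ j, ‖c j‖ ^ 2 = ‖1 - ρ * μ‖ ^ 2 * ∑ i, ‖S.mulVec c i‖ ^ 2 := by rw [one_mul, heq]
      _ ≤ ‖1 - ρ * μ‖ ^ 2 * ((∑ j, ∑ i, ‖S i j‖ ^ 2) * ∑ j, ‖c j‖ ^ 2) := by gcongr
      _ = _ := by ring
  rw [hsum]
  nlinarith

/-- Spectral averaging over the potential at one site. -/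
theorem IsHermitianFamily.integral_poissonDensity_le (hG : IsHermitianFamily G) {a : ℝ} (ha : 0 < a)
    {ρ : ℂ} (hρ : ‖ρ‖ < 1) (v : n → ℝ) (j : n) :
    ∫ t in (-1 : ℝ)..1, poissonDensity G a ρ (Function.update v j t) j ≤
      2 + 2 / a * (Fintype.card n * Real.pi) := by
  set u := Function.update v j with hu
  have huc : Continuous u := continuous_const.update j continuous_id
  let L : ℝ → ℂ := fun t => ∑' m : ℕ, (m : ℂ)⁻¹ * ((ρ • monodromy G a (u t)) ^ m).trace
  have hL : ∀ t, HasDerivAt L ((neumann (ρ • monodromy G a (u t)) *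
      (ρ • -((Complex.I * a) • (monodromy G a (u t) * occupation G a (u t) j)))).trace) t := by
    refine hasDerivAt_tsum_trace_pow (K := a)
      (fun t => (hG.hasDerivAt_monodromy a v j t).const_smul ρ) hρ
      (fun t => hG.norm_smul_monodromy_le a ρ (u t)) (fun t => ?_)
    rw [norm_smul, norm_neg, norm_smul, norm_mul, Complex.norm_I, one_mul, Complex.norm_real,
      Real.norm_of_nonneg ha.le]
    calc ‖ρ‖ * (a * ‖monodromy G a (u t) * occupation G a (u t) j‖)
        ≤ 1 * (a * (1 * 1)) := by
          gcongr
          exact (norm_mul_le _ _).trans (mul_le_mul (hG.norm_flow_le a (u t) 1)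
            (hG.norm_occupation_le a (u t) j) (norm_nonneg _) zero_le_one)
      _ = a := by ring
  -- Here $L=-\log\det(1-\rho U)$ and $L'=-ia\,\mathrm{tr}((S-1)Q_j)$. The summand `s` accounts for
  -- $\mathrm{tr}\,Q_j=1$ in $2S-1=2(S-1)+1$.
  have hF : ∀ t, HasDerivAt (fun s => s - 2 / a * (L s).im) (poissonDensity G a ρ (u t) j) t := by
    intro t
    have h1 := Complex.imCLM.hasFDerivAt.comp_hasDerivAt t (hL t)
    refine ((hasDerivAt_id t).sub (h1.const_mul (2 / a))).congr_deriv ?_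
    have hinv : neumann (ρ • monodromy G a (u t)) * (ρ • monodromy G a (u t)) =
        neumann (ρ • monodromy G a (u t)) - 1 := by
      have : neumann (ρ • monodromy G a (u t)) * (1 - ρ • monodromy G a (u t)) = 1 :=
        geom_series_mul_neg _ ((hG.norm_smul_monodromy_le a ρ (u t)).trans_lt hρ)
      rw [mul_sub, mul_one] at this
      rw [← this]; abel
    have e : neumann (ρ • monodromy G a (u t)) *
        (ρ • -((Complex.I * a) • (monodromy G a (u t) * occupation G a (u t) j))) =
        (-(Complex.I * a)) • ((neumann (ρ • monodromy G a (u t)) - 1) * occupation G a (u t) j) := by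
      rw [← hinv, neg_smul, smul_neg, smul_comm ρ, mul_neg, mul_smul_comm, mul_assoc, smul_mul_assoc]
    have e2 : ((2 : ℂ) • neumann (ρ • monodromy G a (u t)) - 1) * occupation G a (u t) j =
        (2 : ℂ) • ((neumann (ρ • monodromy G a (u t)) - 1) * occupation G a (u t) j) +
          occupation G a (u t) j := by
      rw [sub_mul, sub_mul, one_mul, smul_sub, two_smul ℂ (occupation G a (u t) j), smul_mul_assoc]
      abel
    rw [e, poissonDensity, e2, Matrix.trace_add, Matrix.trace_smul, Matrix.trace_smul,
      hG.trace_occupation]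
    set z := ((neumann (ρ • monodromy G a (u t)) - 1) * occupation G a (u t) j).trace
    simp
    field_simp
    ring
  have hc : Continuous fun t => poissonDensity G a ρ (u t) j :=
    (hG.continuous_poissonDensity a hρ j).comp huc
  rw [intervalIntegral.integral_eq_sub_of_hasDerivAt (fun t _ => hF t) (hc.intervalIntegrable _ _)]
  have hb : ∀ t, |(L t).im| ≤ Fintype.card n * (Real.pi / 2) := fun t =>
    abs_im_tsum_trace_pow_le (hG.star_mul_flow a (u t) 1) hρ
  have h1 := (abs_le.1 (hb 1)).1
  have h2 := (abs_le.1 (hb (-1))).2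
  have h3 : 0 < 2 / a := by positivity
  nlinarith

end SpectralDensity

/-! ### Averaging over the random potential. -/

/-- Domination by Lebesgue measure on $[-1,1]$ reduces an average over one site to a plain integral,
and `M` carries all dependence of the final constant on `g`. -/
theorem HasBoundedDensity.exists_le_smul_restrict {g : Measure ℝ} (hg : HasBoundedDensity g)
    (hs : g.support ⊆ Icc (-1) 1) :
    ∃ M : ℝ≥0, g ≤ (M : ℝ≥0∞) • volume.restrict (Icc (-1) 1) := by
  obtain ⟨ρ, -, ⟨M, hM⟩, hgρ⟩ := hg
  refine ⟨M, ?_⟩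
  have h1 : g ≤ (M : ℝ≥0∞) • volume := by
    rw [hgρ, ← withDensity_const]
    exact withDensity_mono hM
  have h2 : g.restrict (Icc (-1) 1) = g := by
    refine Measure.restrict_eq_self_of_ae_mem ?_
    rw [ae_iff]
    exact measure_mono_null (compl_subset_compl.2 hs) Measure.measure_compl_support
  rw [← h2, ← Measure.restrict_smul]
  exact Measure.restrict_mono le_rfl h1

section

open scoped Matrix.Norms.L2Operator

variable {n : Type*} [Fintype n] [DecidableEq n] {G : ℝ → Matrix n n ℂ}

theorem IsHermitianFamily.lintegral_poissonDensity_le (hG : IsHermitianFamily G) {a : ℝ}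
    (ha : 0 < a) {ρ : ℂ} (hρ : ‖ρ‖ < 1) {g : Measure ℝ} [IsProbabilityMeasure g] {M : ℝ≥0}
    (hM : g ≤ (M : ℝ≥0∞) • volume.restrict (Icc (-1) 1)) (j : n) :
    ∫⁻ v, ENNReal.ofReal (poissonDensity G a ρ v j) ∂Measure.pi (fun _ : n => g) ≤
      ENNReal.ofReal (M * (2 + 2 / a * (Fintype.card n * Real.pi))) := by
  set f : (n → ℝ) → ℝ≥0∞ := fun v => ENNReal.ofReal (poissonDensity G a ρ v j) with hf
  have hfm : Measurable f := (hG.continuous_poissonDensity a hρ j).measurable.ennreal_ofReal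
  have hsite : ∀ v, ∫⁻ t, f (Function.update v j t) ∂g ≤
      ENNReal.ofReal (M * (2 + 2 / a * (Fintype.card n * Real.pi))) := by
    intro v
    have hc : Continuous fun t => poissonDensity G a ρ (Function.update v j t) j :=
      (hG.continuous_poissonDensity a hρ j).comp (continuous_const.update j continuous_id)
    calc ∫⁻ t, f (Function.update v j t) ∂g
        ≤ ∫⁻ t, f (Function.update v j t) ∂((M : ℝ≥0∞) • volume.restrict (Icc (-1) 1)) :=
          lintegral_mono' hM le_rfl
      _ = M * ∫⁻ t in Icc (-1) 1, f (Function.update v j t) := by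
          rw [lintegral_smul_measure, smul_eq_mul]
      _ = M * ENNReal.ofReal (∫ t in (-1 : ℝ)..1, poissonDensity G a ρ (Function.update v j t) j) := by
          rw [intervalIntegral.integral_of_le (by norm_num), ← integral_Icc_eq_integral_Ioc,
            ofReal_integral_eq_lintegral_ofReal hc.continuousOn.integrableOn_Icc
              (Filter.Eventually.of_forall fun t => hG.poissonDensity_nonneg a hρ _ j)]
      _ ≤ M * ENNReal.ofReal (2 + 2 / a * (Fintype.card n * Real.pi)) := by
          gcongr
          exact hG.integral_poissonDensity_le ha hρ v j
      _ = _ := by rw [ENNReal.ofReal_mul M.coe_nonneg, ENNReal.ofReal_coe_nnreal]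
  -- Tonelli: $v_j$ is integrated first, and the resulting bound is uniform in the other
  -- coordinates.
  rw [lintegral_eq_lmarginal_univ (0 : n → ℝ), lmarginal_erase' _ hfm (Finset.mem_univ j)]
  refine (lmarginal_mono (g := fun _ => ENNReal.ofReal (M * (2 + 2 / a * (Fintype.card n * Real.pi))))
    hsite 0).trans ?_
  simp [lmarginal]

/-- The probability that the monodromy matrix has an eigenvalue close to `ρ⁻¹`. -/
theorem IsHermitianFamily.measure_eigenvalue_le (hG : IsHermitianFamily G) {a : ℝ}
    (ha : 0 < a) {ρ : ℂ} (hρ : ‖ρ‖ < 1) {g : Measure ℝ} [IsProbabilityMeasure g] {M : ℝ≥0}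
    (hM : g ≤ (M : ℝ≥0∞) • volume.restrict (Icc (-1) 1)) (δ : ℝ) :
    Measure.pi (fun _ : n => g) {v | ∃ c : n → ℂ, c ≠ 0 ∧ ∃ μ : ℂ,
        (monodromy G a v).mulVec c = μ • c ∧ ‖1 - ρ * μ‖ ≤ δ} ≤
      ENNReal.ofReal (δ ^ 2 / (1 - ‖ρ‖ ^ 2) *
        (Fintype.card n * (M * (2 + 2 / a * (Fintype.card n * Real.pi))))) := by
  have hr : 0 < 1 - ‖ρ‖ ^ 2 := by nlinarith [norm_nonneg ρ]
  have hm : ∀ j, Measurable fun v => ENNReal.ofReal (poissonDensity G a ρ v j) := fun j =>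
    (hG.continuous_poissonDensity a hρ j).measurable.ennreal_ofReal
  have hint : ∫⁻ v, ENNReal.ofReal (δ ^ 2 / (1 - ‖ρ‖ ^ 2)) *
      ∑ j, ENNReal.ofReal (poissonDensity G a ρ v j) ∂Measure.pi (fun _ : n => g) ≤
      ENNReal.ofReal (δ ^ 2 / (1 - ‖ρ‖ ^ 2) *
        (Fintype.card n * (M * (2 + 2 / a * (Fintype.card n * Real.pi))))) := by
    rw [lintegral_const_mul _ (Finset.measurable_fun_sum _ fun j _ => hm j),
      lintegral_finsetSum _ fun j _ => hm j, ENNReal.ofReal_mul (by positivity)]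
    gcongr
    refine (Finset.sum_le_sum fun j _ => hG.lintegral_poissonDensity_le ha hρ hM j).trans_eq ?_
    rw [Finset.sum_const, Finset.card_univ, nsmul_eq_mul,
      ENNReal.ofReal_mul (Nat.cast_nonneg _), ENNReal.ofReal_natCast,
      ENNReal.ofReal_mul M.coe_nonneg]
  -- Markov's inequality at level 1, after scaling the density so that it is at least 1 on the
  -- event. The event itself need not be measurable.
  refine (measure_mono ?_).trans ((meas_ge_le_lintegral_div (ε := 1) ?_ one_ne_zero
    ENNReal.one_ne_top).trans ((div_one _).trans_le hint))
  · rintro v ⟨c, hc, μ, hμ, hδ⟩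
    have h := hG.le_sum_poissonDensity a hρ v hc hμ
    have h0 : 0 ≤ ∑ j, poissonDensity G a ρ v j :=
      Finset.sum_nonneg fun j _ => hG.poissonDensity_nonneg a hρ v j
    rw [mem_ofPred_eq, ← ENNReal.ofReal_sum_of_nonneg fun j _ => hG.poissonDensity_nonneg a hρ v j,
      ← ENNReal.ofReal_mul (by positivity), ENNReal.one_le_ofReal, div_mul_eq_mul_div, one_le_div hr]
    refine h.trans ?_
    gcongr
  · exact ((Finset.measurable_fun_sum _ fun j _ => hm j).const_mul _).aemeasurable

end

/-! ### Fourier coefficients and compact Fourier multipliers. -/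

/-- The `k`-th Fourier coefficient. -/
abbrev coeff (f : L2Circle) (k : ℤ) : ℂ := fourierBasis.repr f k

theorem L2Circle.ext_coeff {f g : L2Circle} (h : ∀ k, coeff f k = coeff g k) : f = g :=
  fourierBasis.repr.injective (by ext k; exact h k)

theorem norm_le_of_norm_coeff_le {f g : L2Circle} (h : ∀ k, ‖coeff f k‖ ≤ ‖coeff g k‖) :
    ‖f‖ ≤ ‖g‖ := by
  rw [← fourierBasis.repr.norm_map f, ← fourierBasis.repr.norm_map g]
  exact lp.norm_mono two_ne_zero h

theorem coeff_add (f g : L2Circle) (k : ℤ) : coeff (f + g) k = coeff f k + coeff g k := by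
  simp [coeff]

theorem coeff_sub (f g : L2Circle) (k : ℤ) : coeff (f - g) k = coeff f k - coeff g k := by
  simp [coeff]

theorem coeff_smul (c : ℂ) (f : L2Circle) (k : ℤ) : coeff (c • f) k = c * coeff f k := by
  simp [coeff]

theorem coeff_sum {ι : Type*} (s : Finset ι) (f : ι → L2Circle) (k : ℤ) :
    coeff (∑ i ∈ s, f i) k = ∑ i ∈ s, coeff (f i) k := by
  simp only [coeff, map_sum, lp.coeFn_sum, Finset.sum_apply]

theorem coeff_mulCos (f : L2Circle) (k : ℤ) :
    coeff (mulCos f) k = (coeff f (k - 1) + coeff f (k + 1)) / 2 := by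
  have hi : Integrable f haarAddCircle := (Lp.memLp f).integrable one_le_two
  simp only [coeff, fourierBasis_repr, fourierCoeff]
  rw [← integral_add (hi.fourier_smul _) (hi.fourier_smul _), ← integral_div]
  refine integral_congr_ae ?_
  filter_upwards [coeFn_mulCos f] with θ hθ
  have h1 : cosFun θ = (fourier 1 θ + fourier (-1) θ) / 2 := by
    rw [fourier_neg]
    change (((fourier 1 θ : ℂ).re : ℝ) : ℂ) = _
    rw [Complex.re_eq_add_conj]
  rw [hθ, h1, show -(k - 1) = -k + 1 by ring, show -(k + 1) = -k + -1 by ring, fourier_add,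
    fourier_add]
  simp only [smul_eq_mul]
  ring

section Multiplier

variable {m : ℤ → ℂ} {c : ℝ}

theorem exists_coeff_eq_mul (hm : ∀ k, ‖m k‖ ≤ c) (f : L2Circle) :
    ∃ h : L2Circle, ∀ k, coeff h k = m k * coeff f k := by
  have hmem : Memℓp (fun k => m k * coeff f k) 2 :=
    (((lp.memℓp (fourierBasis.repr f)).norm).const_mul c).mono fun k => by
      rw [norm_mul]; exact mul_le_mul_of_nonneg_right (hm k) (norm_nonneg _)
  let y : lp (fun _ : ℤ => ℂ) 2 := ⟨fun k => m k * coeff f k, hmem⟩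
  refine ⟨fourierBasis.repr.symm y, fun k => ?_⟩
  rw [coeff, LinearIsometryEquiv.apply_symm_apply]

/-- The linear map on `L²(S¹)` multiplying the `k`-th Fourier coefficient by `m k`. -/
def multiplierLinear (m : ℤ → ℂ) (c : ℝ) (hm : ∀ k, ‖m k‖ ≤ c) : L2Circle →ₗ[ℂ] L2Circle where
  toFun f := (exists_coeff_eq_mul hm f).choose
  map_add' f g := L2Circle.ext_coeff fun k => by
    rw [coeff_add, (exists_coeff_eq_mul hm _).choose_spec, (exists_coeff_eq_mul hm _).choose_spec,
      (exists_coeff_eq_mul hm _).choose_spec, coeff_add, mul_add]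
  map_smul' a f := L2Circle.ext_coeff fun k => by
    rw [coeff_smul, (exists_coeff_eq_mul hm _).choose_spec, (exists_coeff_eq_mul hm _).choose_spec,
      coeff_smul, RingHom.id_apply, mul_left_comm]

theorem coeff_multiplierLinear (hm : ∀ k, ‖m k‖ ≤ c) (f : L2Circle) (k : ℤ) :
    coeff (multiplierLinear m c hm f) k = m k * coeff f k :=
  (exists_coeff_eq_mul hm f).choose_spec k

/-- The operator on `L²(S¹)` multiplying the `k`-th Fourier coefficient by `m k`. -/
def multiplier (m : ℤ → ℂ) (c : ℝ) (hm : ∀ k, ‖m k‖ ≤ c) : L2Circle →L[ℂ] L2Circle :=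
  (multiplierLinear m c hm).mkContinuous c fun f => by
    have hc : 0 ≤ c := (norm_nonneg _).trans (hm 0)
    refine (norm_le_of_norm_coeff_le (g := (c : ℂ) • f) fun k => ?_).trans_eq
      (by rw [norm_smul, Complex.norm_of_nonneg hc])
    rw [coeff_smul, norm_mul, Complex.norm_of_nonneg hc, coeff_multiplierLinear, norm_mul]
    exact mul_le_mul_of_nonneg_right (hm k) (norm_nonneg _)

theorem coeff_multiplier (hm : ∀ k, ‖m k‖ ≤ c) (f : L2Circle) (k : ℤ) :
    coeff (multiplier m c hm f) k = m k * coeff f k :=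
  coeff_multiplierLinear hm f k

/-- A Fourier multiplier that vanishes at infinity is compact. -/
theorem isCompactOperator_multiplier (hm : ∀ k, ‖m k‖ ≤ c)
    (h0 : Filter.Tendsto m Filter.cofinite (nhds 0)) :
    IsCompactOperator (multiplier m c hm) := by
  -- Finite-rank truncations of the multiplier; they converge in operator norm because the symbol
  -- tends to zero.
  let F : Finset ℤ → L2Circle →L[ℂ] L2Circle := fun s =>
    ∑ k ∈ s, (innerSL ℂ (fourierBasis k : L2Circle)).smulRight (m k • (fourierBasis k : L2Circle))
  have hFcoeff : ∀ s f k, coeff (F s f) k = if k ∈ s then m k * coeff f k else 0 := by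
    intro s f k
    simp only [F, sum_apply, coeff_sum, ContinuousLinearMap.smulRight_apply,
      coeff_smul, innerSL_apply_apply]
    have : ∀ l, coeff (fourierBasis l : L2Circle) k = if k = l then 1 else 0 := by
      intro l
      rw [coeff, fourierBasis.repr_self, lp.single_apply, Pi.single_apply]
    simp only [this, mul_ite, mul_one, mul_zero]
    rw [Finset.sum_ite_eq]
    split_ifs
    · rw [coeff, fourierBasis.repr_apply_apply, mul_comm]
    · rfl
  have hF : ∀ s, IsCompactOperator (F s) := by
    intro s
    refine Finset.sum_induction _ (fun T : L2Circle →L[ℂ] L2Circle => IsCompactOperator T)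
      (fun S T hS hT => hS.add hT) isCompactOperator_zero fun k _ => ?_
    have h : IsCompactOperator (innerSL ℂ (fourierBasis k : L2Circle)) :=
      isCompactOperator_of_locallyCompactSpace_dom _
    exact h.clm_comp
      (ContinuousLinearMap.toSpanSingleton ℂ (m k • (fourierBasis k : L2Circle)))
  refine isCompactOperator_of_tendsto (F := F) (l := Filter.atTop) ?_
    (Filter.Eventually.of_forall hF)
  rw [Metric.tendsto_atTop]
  intro ε hε
  have hfin : {k | ¬ ‖m k‖ < ε / 2}.Finite := by
    have := (tendsto_zero_iff_norm_tendsto_zero.1 h0).eventually_lt_const (half_pos hε)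
    exact this
  refine ⟨hfin.toFinset, fun s hs => ?_⟩
  rw [dist_eq_norm]
  refine lt_of_le_of_lt ?_ (half_lt_self hε)
  refine ContinuousLinearMap.opNorm_le_bound _ (half_pos hε).le fun f => ?_
  rw [← Complex.norm_of_nonneg (half_pos hε).le, ← norm_smul]
  refine norm_le_of_norm_coeff_le fun k => ?_
  rw [sub_apply, coeff_sub, coeff_multiplier, hFcoeff, coeff_smul, norm_mul,
    Complex.norm_of_nonneg (half_pos hε).le]
  split_ifs with hk
  · rw [sub_self, norm_zero]; positivity
  · have hk' : ‖m k‖ < ε / 2 := by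
      by_contra h
      exact hk (hs (hfin.mem_toFinset.2 h))
    rw [zero_sub, norm_neg, norm_mul]
    exact mul_le_mul_of_nonneg_right hk'.le (norm_nonneg _)

end Multiplier

/-! ### The resolvent of $(\omega/i)\,\partial_\theta$ at $i$. -/

section FreeResolvent

variable {ω : ℝ}

theorem sub_I_ne_zero (ω : ℝ) (k : ℤ) : (2 * Real.pi * ω * k : ℂ) - Complex.I ≠ 0 := by
  intro h
  have := congrArg Complex.im h
  rw [show (2 * Real.pi * ω * k : ℂ) = ((2 * Real.pi * ω * k : ℝ) : ℂ) by push_cast; ring] at this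
  simp at this

/-- The symbol of the resolvent of `(ω / i) ∂/∂θ` at `i`. -/
def freeSymbol (ω : ℝ) (k : ℤ) : ℂ := ((2 * Real.pi * ω * k : ℂ) - Complex.I)⁻¹

theorem norm_sub_I_sq (ω : ℝ) (k : ℤ) :
    ‖(2 * Real.pi * ω * k : ℂ) - Complex.I‖ ^ 2 = (2 * Real.pi * ω * k) ^ 2 + 1 := by
  rw [← Complex.normSq_eq_norm_sq,
    show (2 * Real.pi * ω * k : ℂ) = ((2 * Real.pi * ω * k : ℝ) : ℂ) by push_cast; ring,
    Complex.normSq_apply]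
  simp
  ring

theorem norm_freeSymbol_le (ω : ℝ) (k : ℤ) : ‖freeSymbol ω k‖ ≤ 1 := by
  rw [freeSymbol, norm_inv]
  apply inv_le_one_of_one_le₀
  have := norm_sub_I_sq ω k
  nlinarith [norm_nonneg ((2 * Real.pi * ω * k : ℂ) - Complex.I), sq_nonneg (2 * Real.pi * ω * k)]

theorem abs_le_norm_sub_I (ω : ℝ) (k : ℤ) :
    |2 * Real.pi * ω * k| ≤ ‖(2 * Real.pi * ω * k : ℂ) - Complex.I‖ := by
  apply abs_le_of_sq_le_sq _ (norm_nonneg _)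
  rw [norm_sub_I_sq]
  linarith

theorem tendsto_freeSymbol (hω : 0 < ω) :
    Filter.Tendsto (freeSymbol ω) Filter.cofinite (nhds 0) := by
  refine Filter.tendsto_inv₀_cobounded.comp ?_
  rw [← tendsto_norm_atTop_iff_cobounded]
  refine Filter.tendsto_atTop_mono (abs_le_norm_sub_I ω) ?_
  have h1 : Filter.Tendsto (fun k : ℤ => ‖(k : ℝ)‖) Filter.cofinite Filter.atTop :=
    tendsto_norm_cobounded_atTop.comp
      (Int.tendsto_coe_cofinite.mono_right (Metric.cobounded_eq_cocompact (α := ℝ)).ge)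
  refine (h1.const_mul_atTop (show 0 < 2 * Real.pi * ω by positivity)).congr fun k => ?_
  rw [Real.norm_eq_abs, abs_mul, abs_of_pos (show 0 < 2 * Real.pi * ω by positivity)]

/-- The resolvent of `(ω / i) ∂/∂θ` at `i`. -/
def freeResolvent (ω : ℝ) : L2Circle →L[ℂ] L2Circle :=
  multiplier (freeSymbol ω) 1 (norm_freeSymbol_le ω)

theorem coeff_derivTheta (f : sobolevH1) (k : ℤ) :
    coeff (derivTheta f) k = 2 * Real.pi * Complex.I * k * coeff (f : L2Circle) k :=
  (isWeakDeriv_iff _ _).1 ((derivTheta_eq_iff f _).1 rfl) k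

theorem freeResolvent_mem (hω : 0 < ω) (f : L2Circle) : freeResolvent ω f ∈ sobolevH1 := by
  -- The symbol of the derivative of the resolvent is bounded, so that derivative is again in $L^2$.
  have hb : ∀ k : ℤ, ‖2 * Real.pi * Complex.I * k * freeSymbol ω k‖ ≤ ω⁻¹ := by
    intro k
    rw [freeSymbol, norm_mul, norm_inv, mul_inv_le_iff₀ (norm_pos_iff.2 (sub_I_ne_zero ω k))]
    refine le_trans (le_of_eq ?_)
      (mul_le_mul_of_nonneg_left (abs_le_norm_sub_I ω k) (inv_nonneg.2 hω.le))
    rw [← abs_of_pos (inv_pos.2 hω), ← abs_mul,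
      show ω⁻¹ * (2 * Real.pi * ω * k) = 2 * Real.pi * k by field_simp]
    simp [abs_mul]
  refine ⟨multiplier _ _ hb f, (isWeakDeriv_iff _ _).2 fun k => ?_⟩
  change coeff _ k = _ * coeff _ k
  rw [coeff_multiplier, freeResolvent, coeff_multiplier, mul_assoc _ (freeSymbol ω k)]

theorem freeResolvent_right_inv (hω : 0 < ω) (f : L2Circle) :
    ((ω : ℂ) / Complex.I) • derivTheta ⟨freeResolvent ω f, freeResolvent_mem hω f⟩ =
      f + Complex.I • freeResolvent ω f := by
  apply L2Circle.ext_coeff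
  intro k
  rw [coeff_smul, coeff_derivTheta, coeff_add, coeff_smul]
  simp only [freeResolvent, coeff_multiplier]
  have h : ((2 * Real.pi * ω * k : ℂ) - Complex.I) * freeSymbol ω k = 1 :=
    mul_inv_cancel₀ (sub_I_ne_zero ω k)
  have e : (ω : ℂ) / Complex.I * (2 * Real.pi * Complex.I * k * (freeSymbol ω k * coeff f k)) =
      2 * Real.pi * ω * k * freeSymbol ω k * coeff f k := by
    field_simp
  rw [e]
  linear_combination coeff f k * h

theorem freeResolvent_left_inv (f : sobolevH1) :
    freeResolvent ω (((ω : ℂ) / Complex.I) • derivTheta f - Complex.I • (f : L2Circle)) = f := by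
  apply L2Circle.ext_coeff
  intro k
  rw [freeResolvent, coeff_multiplier, coeff_sub, coeff_smul, coeff_smul, coeff_derivTheta]
  have h := sub_I_ne_zero ω k
  rw [freeSymbol]
  field_simp

end FreeResolvent

/-! ### The operator on the box and the discreteness of its spectrum. -/

variable {d : ℕ} {Λ : Finset (Fin d → ℤ)}

/-- The inclusion of the fibre over a site. -/
def boxSingle (j : Λ) : L2Circle →L[ℂ] BoxSpace Λ :=
  ((PiLp.continuousLinearEquiv 2 ℂ fun _ : Λ => L2Circle).symm :
    (Λ → L2Circle) →L[ℂ] BoxSpace Λ).comp (ContinuousLinearMap.single ℂ (fun _ : Λ => L2Circle) j)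

/-- The operator on `ℓ²(Λ) ⊗ L²(S¹)` with the operator-valued matrix `T`. -/
def boxOp (T : Λ → Λ → L2Circle →L[ℂ] L2Circle) : BoxSpace Λ →L[ℂ] BoxSpace Λ :=
  ∑ j, (boxSingle j).comp (∑ i, (T j i).comp (PiLp.proj 2 (fun _ : Λ => L2Circle) i))

theorem boxOp_apply (T : Λ → Λ → L2Circle →L[ℂ] L2Circle) (ψ : BoxSpace Λ) (j : Λ) :
    boxOp T ψ j = ∑ i, T j i (ψ i) := by
  have h : ∀ (k : Λ) (f : L2Circle), boxSingle k f j = if j = k then f else 0 := by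
    intro k f
    change (Pi.single k f : Λ → L2Circle) j = _
    rw [Pi.single_apply]
  have h2 : boxOp T ψ = ∑ k, boxSingle k (∑ i, T k i (ψ i)) := by
    simp [boxOp, sum_apply]
  rw [h2, WithLp.ofLp_sum, Finset.sum_apply]
  simp only [h]
  rw [Finset.sum_ite_eq, if_pos (Finset.mem_univ j)]

theorem isCompactOperator_boxOp {T : Λ → Λ → L2Circle →L[ℂ] L2Circle}
    (hT : ∀ j i, IsCompactOperator (T j i)) : IsCompactOperator (boxOp T) := by
  refine Finset.sum_induction _ (fun S : BoxSpace Λ →L[ℂ] BoxSpace Λ => IsCompactOperator S)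
    (fun S S' hS hS' => hS.add hS') isCompactOperator_zero fun j _ => ?_
  have h : IsCompactOperator
      (∑ i, (T j i).comp (PiLp.proj 2 (fun _ : Λ => L2Circle) i) : BoxSpace Λ →L[ℂ] L2Circle) := by
    refine Finset.sum_induction _ (fun S : BoxSpace Λ →L[ℂ] L2Circle => IsCompactOperator S)
      (fun S S' hS hS' => hS.add hS') isCompactOperator_zero fun i _ => ?_
    exact (hT j i).comp_clm _
  exact h.clm_comp (boxSingle j)

/-- The resolvent of `(ω / i) ∂/∂θ` at `i` on `ℓ²(Λ) ⊗ L²(S¹)`. -/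
def boxFreeResolvent (Λ : Finset (Fin d → ℤ)) (ω : ℝ) : BoxSpace Λ →L[ℂ] BoxSpace Λ :=
  boxOp fun j i => if i = j then freeResolvent ω else 0

theorem boxFreeResolvent_apply (ω : ℝ) (ψ : BoxSpace Λ) (j : Λ) :
    boxFreeResolvent Λ ω ψ j = freeResolvent ω (ψ j) := by
  rw [boxFreeResolvent, boxOp_apply, Finset.sum_eq_single j]
  · rw [if_pos rfl]
  · intro i _ hi
    rw [if_neg hi]; rfl
  · intro h; exact (h (Finset.mem_univ j)).elim

/-- The bounded part `Δ_Λ + γ V + λ cos (2πθ) W` of the quasi-energy operator. -/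
def boundedPart (Λ : Finset (Fin d → ℤ)) (γ lam : ℝ) (v W : (Fin d → ℤ) → ℝ) :
    BoxSpace Λ →L[ℂ] BoxSpace Λ :=
  boxOp fun j i => laplacian (j : Fin d → ℤ) i • ContinuousLinearMap.id ℂ L2Circle +
    if i = j then ((γ * v j : ℝ) : ℂ) • ContinuousLinearMap.id ℂ L2Circle +
      ((lam * W j : ℝ) : ℂ) • mulCos else 0

theorem boundedPart_apply (γ lam : ℝ) (v W : (Fin d → ℤ) → ℝ) (ψ : BoxSpace Λ) (j : Λ) :
    boundedPart Λ γ lam v W ψ j = ∑ i : Λ, laplacian (j : Fin d → ℤ) i • ψ i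
      + ((γ * v j : ℝ) : ℂ) • ψ j + ((lam * W j : ℝ) : ℂ) • mulCos (ψ j) := by
  rw [boundedPart, boxOp_apply]
  simp only [add_apply]
  rw [Finset.sum_add_distrib, add_assoc]
  congr 1
  rw [Finset.sum_eq_single j]
  · rw [if_pos rfl]; rfl
  · intro i _ hi
    rw [if_neg hi]; rfl
  · intro h; exact (h (Finset.mem_univ j)).elim

variable {ω γ lam : ℝ} {v W : (Fin d → ℤ) → ℝ}

theorem boxFreeResolvent_mem (hω : 0 < ω) (φ : BoxSpace Λ) :
    boxFreeResolvent Λ ω φ ∈ (quasiEnergy Λ ω γ lam v W).domain := fun j => by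
  rw [boxFreeResolvent_apply]
  exact freeResolvent_mem hω (φ j)

theorem quasiEnergy_boxFreeResolvent (hω : 0 < ω) (φ : BoxSpace Λ) :
    quasiEnergy Λ ω γ lam v W ⟨boxFreeResolvent Λ ω φ, boxFreeResolvent_mem hω φ⟩ =
      φ + Complex.I • boxFreeResolvent Λ ω φ +
        boundedPart Λ γ lam v W (boxFreeResolvent Λ ω φ) := by
  ext1 j
  have h : derivTheta ⟨boxFreeResolvent Λ ω φ j, boxFreeResolvent_mem (γ := γ) (lam := lam)
      (v := v) (W := W) hω φ j⟩ = derivTheta ⟨freeResolvent ω (φ j), freeResolvent_mem hω (φ j)⟩ := by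
    congr 1
    exact Subtype.ext (boxFreeResolvent_apply ω φ j)
  rw [quasiEnergy_apply, h, freeResolvent_right_inv hω, PiLp.add_apply, PiLp.add_apply,
    PiLp.smul_apply, boundedPart_apply, boxFreeResolvent_apply]
  abel

theorem boxFreeResolvent_quasiEnergy (ψ : (quasiEnergy Λ ω γ lam v W).domain) :
    boxFreeResolvent Λ ω (quasiEnergy Λ ω γ lam v W ψ - boundedPart Λ γ lam v W ψ -
      Complex.I • (ψ : BoxSpace Λ)) = ψ := by
  ext1 j
  rw [boxFreeResolvent_apply, PiLp.sub_apply, PiLp.sub_apply, PiLp.smul_apply, quasiEnergy_apply,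
    boundedPart_apply]
  convert freeResolvent_left_inv (ω := ω) ⟨ψ.1 j, ψ.2 j⟩ using 2
  abel

/-- The spectrum of the quasi-energy operator consists of eigenvalues. -/
theorem exists_eigenvector (hω : 0 < ω) {z : ℂ}
    (hz : z ∈ unboundedSpectrum (quasiEnergy Λ ω γ lam v W)) :
    ∃ ψ : (quasiEnergy Λ ω γ lam v W).domain, (ψ : BoxSpace Λ) ≠ 0 ∧
      quasiEnergy Λ ω γ lam v W ψ = z • (ψ : BoxSpace Λ) := by
  set K := quasiEnergy Λ ω γ lam v W with hK
  set R := boxFreeResolvent Λ ω with hR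
  set B : BoxSpace Λ →L[ℂ] BoxSpace Λ :=
    (z - Complex.I) • ContinuousLinearMap.id ℂ (BoxSpace Λ) - boundedPart Λ γ lam v W with hB
  have hBapp : ∀ ψ, B ψ = z • ψ - Complex.I • ψ - boundedPart Λ γ lam v W ψ := fun ψ => by
    rw [hB, sub_apply, ← sub_smul]; rfl
  -- This is $(K-z)R=1-BR$ with $BR$ compact. By the Fredholm alternative, either 1 is an eigenvalue
  -- of $BR$, and $R$ maps its eigenvector to one of $K$, or $R(1-BR)^{-1}$ is a bounded inverse of
  -- $K-z$.
  have hKR : ∀ φ, K ⟨R φ, boxFreeResolvent_mem hω φ⟩ - z • R φ = φ - B (R φ) := fun φ => by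
    rw [quasiEnergy_boxFreeResolvent hω, hBapp]
    abel
  have hRcomp : IsCompactOperator R := isCompactOperator_boxOp fun j i => by
    split_ifs
    · exact isCompactOperator_multiplier _ (tendsto_freeSymbol hω)
    · exact isCompactOperator_zero
  have hT : IsCompactOperator (B.comp R) := hRcomp.clm_comp B
  rcases hT.hasEigenvalue_or_mem_resolventSet one_ne_zero with h | h
  · obtain ⟨φ, hφ⟩ := h.exists_hasEigenvector
    have hφ1 : B (R φ) = φ := by simpa using! hφ.apply_eq_smul
    refine ⟨⟨R φ, boxFreeResolvent_mem hω φ⟩, fun h0 => hφ.2 ?_, ?_⟩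
    · have h0' : R φ = 0 := h0
      rw [← hφ1, h0', map_zero]
    · rw [← sub_eq_zero]
      exact (hKR φ).trans (by rw [hφ1, sub_self])
  · exfalso
    apply hz
    rw [spectrum.mem_resolventSet_iff, map_one] at h
    obtain ⟨u, hu⟩ := h
    set S : BoxSpace Λ →L[ℂ] BoxSpace Λ := ↑u⁻¹ with hS
    have h1 : ∀ φ, S φ - B (R (S φ)) = φ := fun φ => by
      have := congrArg (fun A : BoxSpace Λ →L[ℂ] BoxSpace Λ => A φ) u.mul_inv
      rw [hu] at this
      exact this
    have h2 : ∀ φ, S (φ - B (R φ)) = φ := fun φ => by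
      have := congrArg (fun A : BoxSpace Λ →L[ℂ] BoxSpace Λ => A φ) u.inv_mul
      rw [hu] at this
      exact this
    refine ⟨R.comp S, fun φ => ⟨boxFreeResolvent_mem hω _, (hKR (S φ)).trans (h1 φ)⟩, fun ψ => ?_⟩
    set φ := K ψ - boundedPart Λ γ lam v W ψ - Complex.I • (ψ : BoxSpace Λ) with hφ
    have hψ : R φ = ψ := boxFreeResolvent_quasiEnergy ψ
    have e : K ψ - z • (ψ : BoxSpace Λ) = φ - B (R φ) := by
      rw [hψ, hBapp, hφ]
      abel
    rw [e]
    change R (S (φ - B (R φ))) = ψ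
    rw [h2, hψ]

/-! ### Uniqueness for the linear equation. -/

section Uniqueness

open scoped Matrix.Norms.L2Operator

variable {n : Type*} [Fintype n] [DecidableEq n]

theorem IsHermitianFamily.eq_flow_mul {G : ℝ → Matrix n n ℂ} (hG : IsHermitianFamily G) (a : ℝ)
    (v : n → ℝ) {M : ℝ → Matrix n n ℂ} (hM : ∀ t, HasDerivAt M (generator G a v t * M t) t) (t : ℝ) :
    M t = flow G a v t * M 0 := by
  have hB := hG.isSkewGenerator a v
  have hd : ∀ s, HasDerivAt (fun s => star (flow G a v s) * M s) 0 s := fun s => by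
    refine ((hB.hasDerivAt s).star.mul (hM s)).congr_deriv ?_
    rw [star_mul, hB.star_eq]
    change star (flow G a v s) * -generator G a v s * M s +
      star (flow G a v s) * (generator G a v s * M s) = 0
    noncomm_ring
  have h := is_const_of_deriv_eq_zero (fun s => (hd s).differentiableAt) (fun s => (hd s).deriv) t 0
  have h0 : flow G a v 0 = 1 := propagator_zero _
  rw [h0, star_one, one_mul] at h
  rw [← h, ← mul_assoc, hG.flow_mul_star, one_mul]

/-- The square matrix all of whose columns are a given vector. -/
def constColumns {n : Type*} [Fintype n] : (n → ℂ) →L[ℝ] Matrix n n ℂ :=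
  LinearMap.toContinuousLinearMap
    { toFun w := Matrix.of fun i _ => w i
      map_add' _ _ := rfl
      map_smul' _ _ := rfl }

theorem mul_constColumns {n : Type*} [Fintype n] (A : Matrix n n ℂ) (w : n → ℂ) :
    A * constColumns w = constColumns (A.mulVec w) := by
  ext i j
  rfl

theorem IsHermitianFamily.eq_flow_mulVec {G : ℝ → Matrix n n ℂ} (hG : IsHermitianFamily G) (a : ℝ)
    (v : n → ℝ) {w : ℝ → n → ℂ} (hw : ∀ t, HasDerivAt w ((generator G a v t).mulVec (w t)) t)
    (t : ℝ) : w t = (flow G a v t).mulVec (w 0) := by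
  -- A vector solution repeated in every column is a matrix solution, so the matrix case applies.
  have h := hG.eq_flow_mul a v (M := fun t => constColumns (w t)) (fun t => by
    rw [mul_constColumns]
    exact constColumns.hasFDerivAt.comp_hasDerivAt t (hw t)) t
  rw [mul_constColumns] at h
  funext i
  exact congrFun (congrFun h i) i

end Uniqueness

/-! ### Exponentials and absolutely convergent Fourier series. -/

/-- The exponential `exp (2πi k θ)`. -/
def expFun (k : ℤ) (θ : ℝ) : ℂ := fourier k (θ : UnitAddCircle)

theorem norm_expFun (k : ℤ) (θ : ℝ) : ‖expFun k θ‖ = 1 := by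
  rw [expFun, fourier_apply, Circle.norm_coe]

theorem expFun_add (k l : ℤ) (θ : ℝ) : expFun (k + l) θ = expFun k θ * expFun l θ := fourier_add

theorem hasDerivAt_expFun (k : ℤ) (θ : ℝ) :
    HasDerivAt (expFun k) (2 * Real.pi * Complex.I * k * expFun k θ) θ := by
  have h := hasDerivAt_fourier 1 k θ
  rw [Complex.ofReal_one, div_one] at h
  exact h

theorem expFun_zero_right (k : ℤ) : expFun k 0 = 1 := by
  rw [expFun]
  exact fourier_eval_zero k

theorem expFun_one_right (k : ℤ) : expFun k 1 = 1 := by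
  have h : ((1 : ℝ) : UnitAddCircle) = ((0 : ℝ) : UnitAddCircle) := by
    rw [AddCircle.coe_period]; rfl
  rw [expFun, h]
  exact fourier_eval_zero k

theorem expFun_cos (θ : ℝ) : (expFun 1 θ + expFun (-1) θ) / 2 = (Real.cos (2 * Real.pi * θ) : ℂ) := by
  rw [← cosFun_coe, expFun, expFun, fourier_neg]
  change _ = (((fourier 1 (θ : UnitAddCircle) : ℂ).re : ℝ) : ℂ)
  rw [Complex.re_eq_add_conj]

/-- For $k\ne0$, $2|x_k|\le k^{-2}+|kx_k|^2$; the term $k=0$ is added separately. -/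
theorem summable_norm_of_summable_sq {x : ℤ → ℂ} (hx : Summable fun k : ℤ => ‖(k : ℂ) * x k‖ ^ 2) :
    Summable fun k => ‖x k‖ := by
  have h1 : Summable fun k : ℤ => 1 / (k : ℝ) ^ 2 := Real.summable_one_div_int_pow.2 one_lt_two
  have h2 : Summable fun k : ℤ => if k = 0 then ‖x 0‖ else 0 :=
    summable_of_ne_finset_zero (s := {0}) fun k hk => if_neg (by simpa using hk)
  refine Summable.of_nonneg_of_le (fun k => norm_nonneg _) (fun k => ?_) ((h1.add hx).add h2)
  by_cases hk : k = 0
  · subst hk; simp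
  · rw [if_neg hk, add_zero, norm_mul, Complex.norm_intCast, mul_pow, sq_abs]
    have hk0 : |(k : ℝ)| ≠ 0 := by positivity
    have h3 := two_mul_le_add_sq (|(k : ℝ)|⁻¹) (|(k : ℝ)| * ‖x k‖)
    rw [mul_assoc, inv_mul_cancel_left₀ hk0, inv_pow, mul_pow, sq_abs, ← one_div] at h3
    linarith [norm_nonneg (x k)]

theorem summable_sq_coeff (f : L2Circle) : Summable fun k => ‖coeff f k‖ ^ 2 := by
  have h := (lp.memℓp (fourierBasis.repr f)).summable (by norm_num)
  simpa using h

theorem eq_zero_of_tsum_expFun_eq_zero {f : L2Circle} (hf : Summable fun k => ‖coeff f k‖)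
    (h : ∀ θ, ∑' k, coeff f k * expFun k θ = 0) : f = 0 := by
  have hs : Summable fun k => coeff f k • (fourier k : C(UnitAddCircle, ℂ)) := by
    refine Summable.of_norm (hf.congr fun k => ?_)
    rw [norm_smul, fourier_norm, mul_one]
  have h0 : ∑' k, coeff f k • (fourier k : C(UnitAddCircle, ℂ)) = 0 := by
    ext x
    obtain ⟨θ, rfl⟩ := QuotientAddGroup.mk_surjective x
    change (∑' k, coeff f k • (fourier k : C(UnitAddCircle, ℂ))) (θ : UnitAddCircle) = 0
    rw [← ContinuousMap.tsum_apply hs]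
    exact h θ
  have h1 := hs.hasSum.map (ContinuousMap.toLp (E := ℂ) 2 (haarAddCircle : Measure UnitAddCircle) ℂ)
    (ContinuousMap.toLp (E := ℂ) 2 (haarAddCircle : Measure UnitAddCircle) ℂ).continuous
  rw [h0, map_zero] at h1
  refine (hasSum_fourier_series_L2 f).unique ?_
  convert h1 using 2 with k
  simp only [Function.comp, map_smul, coeff, fourierBasis_repr]

/-! ### From eigenvectors of the quasi-energy operator to Floquet solutions. -/

section Box

open scoped Matrix.Norms.L2Operator

variable {d : ℕ} {Λ : Finset (Fin d → ℤ)} {ω γ lam : ℝ} {v W : (Fin d → ℤ) → ℝ}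

/-- The deterministic part `ω⁻¹ (Δ_Λ + λ cos (2πθ) W)`, as a family of matrices. -/
def boxFamily (Λ : Finset (Fin d → ℤ)) (ω lam : ℝ) (W : (Fin d → ℤ) → ℝ) (θ : ℝ) : Matrix Λ Λ ℂ :=
  (ω : ℂ)⁻¹ • (Matrix.of (fun j i : Λ => laplacian (j : Fin d → ℤ) i) +
    (Real.cos (2 * Real.pi * θ) : ℂ) • realDiag fun j : Λ => lam * W j)

theorem laplacian_comm (i j : Fin d → ℤ) : laplacian i j = laplacian j i := by
  have h : l1Norm (i - j) = l1Norm (j - i) := by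
    simp only [l1Norm, Pi.sub_apply, abs_sub_comm]
  rw [laplacian, laplacian, h]

theorem isHermitianFamily_boxFamily (Λ : Finset (Fin d → ℤ)) (ω lam : ℝ) (W : (Fin d → ℤ) → ℝ) :
    IsHermitianFamily (boxFamily Λ ω lam W) where
  continuous := by
    have hc : Continuous fun θ : ℝ => (Real.cos (2 * Real.pi * θ) : ℂ) := by fun_prop
    have h1 := hc.smul (continuous_const (y := realDiag fun j : Λ => lam * W j))
    have h2 := (continuous_const (y := Matrix.of fun j i : Λ => laplacian (j : Fin d → ℤ) i)).add h1
    exact h2.const_smul ((ω : ℂ)⁻¹)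
  bounded := by
    refine ⟨‖(ω : ℂ)⁻¹‖ * (‖Matrix.of fun j i : Λ => laplacian (j : Fin d → ℤ) i‖ +
      1 * ‖(realDiag fun j : Λ => lam * W j : Matrix Λ Λ ℂ)‖), fun θ => ?_⟩
    rw [boxFamily, norm_smul]
    gcongr
    refine (norm_add_le _ _).trans ?_
    rw [norm_smul]
    gcongr
    rw [Complex.norm_real]
    exact Real.abs_cos_le_one _
  star_eq θ := by
    rw [boxFamily, star_smul, star_add, star_smul, star_realDiag]
    congr 1
    · simp
    · congr 1
      · ext i j
        rw [Matrix.star_apply, Matrix.of_apply, Matrix.of_apply, laplacian_comm]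
        rw [laplacian]
        split_ifs <;> simp
      · congr 1
        exact Complex.conj_ofReal _

/-- The eigenvalue equation, solved for the coefficients of $\partial_\theta\psi_j$. The right side
involves no factor $k$, so it stays summable and justifies termwise differentiation. -/
theorem coeff_eigenvector {z : ℂ} {ψ : (quasiEnergy Λ ω γ lam v W).domain}
    (hψ : quasiEnergy Λ ω γ lam v W ψ = z • (ψ : BoxSpace Λ)) (hω : 0 < ω) (j : Λ) (k : ℤ) :
    2 * Real.pi * Complex.I * k * coeff (ψ.1 j) k =
      Complex.I / ω * (z * coeff (ψ.1 j) k -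
        (∑ i : Λ, laplacian (j : Fin d → ℤ) i * coeff (ψ.1 i) k + γ * v j * coeff (ψ.1 j) k +
          lam * W j * ((coeff (ψ.1 j) (k - 1) + coeff (ψ.1 j) (k + 1)) / 2))) := by
  have h := congrArg (fun φ : BoxSpace Λ => coeff (φ j) k) hψ
  simp only [quasiEnergy_apply, PiLp.smul_apply, coeff_add, coeff_smul, coeff_sum, coeff_mulCos,
    coeff_derivTheta] at h
  have hω' : (ω : ℂ) ≠ 0 := by exact_mod_cast hω.ne'
  have e : (ω : ℂ) / Complex.I * (2 * Real.pi * Complex.I * k * coeff (ψ.1 j) k) =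
      2 * Real.pi * ω * k * coeff (ψ.1 j) k := by
    field_simp
  rw [e] at h
  push_cast at h
  rw [← h]
  field_simp
  ring

theorem summable_norm_coeff {f : L2Circle} (hf : f ∈ sobolevH1) : Summable fun k => ‖coeff f k‖ := by
  refine summable_norm_of_summable_sq ?_
  have h := (summable_sq_coeff (derivTheta ⟨f, hf⟩)).mul_left ((2 * Real.pi) ^ 2)⁻¹
  refine h.congr fun k => ?_
  rw [coeff_derivTheta, mul_assoc, norm_mul]
  have : ‖2 * (Real.pi : ℂ) * Complex.I‖ = 2 * Real.pi := by
    simp [abs_of_pos Real.pi_pos]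
  rw [this, mul_pow (2 * Real.pi) ‖_‖, inv_mul_cancel_left₀ (by positivity)]

/-- An eigenvector of the quasi-energy operator gives a Floquet solution. -/
theorem exists_monodromy_eigenvector (hω : 0 < ω) {z : ℂ}
    (hz : z ∈ unboundedSpectrum (quasiEnergy Λ ω γ lam v W)) :
    ∃ c : Λ → ℂ, c ≠ 0 ∧
      (monodromy (boxFamily Λ ω lam W) (γ / ω) fun j : Λ => v j).mulVec c =
        Complex.exp (-(Complex.I * z / ω)) • c := by
  obtain ⟨ψ, hψ0, hψ⟩ := exists_eigenvector hω hz
  have hω' : (ω : ℂ) ≠ 0 := by exact_mod_cast hω.ne'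
  have hG := isHermitianFamily_boxFamily Λ ω lam W
  let x : Λ → ℤ → ℂ := fun j k => coeff (ψ.1 j) k
  have hxs : ∀ j, Summable fun k => ‖x j k‖ := fun j => summable_norm_coeff (ψ.2 j)
  let h : ℝ → Λ → ℂ := fun θ j => ∑' k, x j k * expFun k θ
  have hxsum : ∀ j θ, HasSum (fun k => x j k * expFun k θ) (h θ j) := fun j θ =>
    (Summable.of_norm ((hxs j).congr fun k => by rw [norm_mul, norm_expFun, mul_one])).hasSum
  let y : Λ → ℤ → ℂ := fun j k => Complex.I / ω * (z * x j k -
    (∑ i : Λ, laplacian (j : Fin d → ℤ) i * x i k + γ * v j * x j k +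
      lam * W j * ((x j (k - 1) + x j (k + 1)) / 2)))
  have hxy : ∀ j k, 2 * Real.pi * Complex.I * k * x j k = y j k := coeff_eigenvector hψ hω
  have hminus : ∀ j θ, HasSum (fun k => x j (k - 1) * expFun k θ) (expFun 1 θ * h θ j) := by
    intro j θ
    refine (Equiv.addRight (1 : ℤ)).hasSum_iff.1 (((hxsum j θ).mul_left (expFun 1 θ)).congr_fun
      fun k => ?_)
    simp only [Function.comp, Equiv.coe_addRight, add_sub_cancel_right, expFun_add]
    ring
  have hplus : ∀ j θ, HasSum (fun k => x j (k + 1) * expFun k θ) (expFun (-1) θ * h θ j) := by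
    intro j θ
    refine (Equiv.addRight (-1 : ℤ)).hasSum_iff.1 (((hxsum j θ).mul_left (expFun (-1) θ)).congr_fun
      fun k => ?_)
    simp only [Function.comp, Equiv.coe_addRight, neg_add_cancel_right, expFun_add]
    ring
  have hysum : ∀ j θ, HasSum (fun k => y j k * expFun k θ) (Complex.I / ω * (z * h θ j -
      (∑ i : Λ, laplacian (j : Fin d → ℤ) i * h θ i + γ * v j * h θ j +
        lam * W j * (Real.cos (2 * Real.pi * θ) * h θ j)))) := by
    intro j θ
    have hs := (((hxsum j θ).mul_left z).sub (((hasSum_sum fun i (_ : i ∈ Finset.univ) =>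
      (hxsum i θ).mul_left (laplacian (j : Fin d → ℤ) i)).add
      ((hxsum j θ).mul_left (γ * v j : ℂ))).add
      (((hminus j θ).add (hplus j θ)).mul_left (lam * W j / 2 : ℂ)))).mul_left (Complex.I / ω)
    rw [← expFun_cos]
    have e : Complex.I / ω * (z * h θ j - (∑ i : Λ, laplacian (j : Fin d → ℤ) i * h θ i +
        γ * v j * h θ j + lam * W j * ((expFun 1 θ + expFun (-1) θ) / 2 * h θ j))) =
        Complex.I / ω * (z * h θ j - (∑ i : Λ, laplacian (j : Fin d → ℤ) i * h θ i +
        γ * v j * h θ j + lam * W j / 2 * (expFun 1 θ * h θ j + expFun (-1) θ * h θ j))) := by ring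
    rw [e]
    refine hs.congr_fun fun k => ?_
    simp only [y, ← mul_assoc, ← Finset.sum_mul]
    ring
  -- Summability in ℂ is absolute, so convergence at $\theta=0$ is enough.
  have hys : ∀ j, Summable fun k => ‖y j k‖ := fun j => by
    refine (hysum j 0).summable.norm.congr fun k => ?_
    rw [norm_mul, norm_expFun, mul_one]
  have hderiv : ∀ j θ, HasDerivAt (fun θ => h θ j) (Complex.I / ω * (z * h θ j -
      (∑ i : Λ, laplacian (j : Fin d → ℤ) i * h θ i + γ * v j * h θ j +
        lam * W j * (Real.cos (2 * Real.pi * θ) * h θ j)))) θ := by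
    intro j θ
    rw [← (hysum j θ).tsum_eq]
    refine hasDerivAt_tsum (g := fun k θ => x j k * expFun k θ) (g' := fun k θ => y j k * expFun k θ)
      (y₀ := θ) (hys j) (fun k t => ?_) (fun k t => ?_) (hxsum j θ).summable θ
    · refine ((hasDerivAt_expFun k t).const_mul (x j k)).congr_deriv ?_
      rw [← hxy]
      ring
    · rw [norm_mul, norm_expFun, mul_one]
  -- The exponential factor removes $z$ from the equation. As `h` is 1-periodic, only this factor
  -- changes over a period, which gives the eigenvalue.
  let w : ℝ → Λ → ℂ := fun θ j => Complex.exp (-(Complex.I * z / ω) * θ) * h θ j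
  have hw : ∀ θ, HasDerivAt w
      ((generator (boxFamily Λ ω lam W) (γ / ω) (fun j : Λ => v j) θ).mulVec (w θ)) θ := by
    intro θ
    refine hasDerivAt_pi.2 fun j => ?_
    have h1 : HasDerivAt (fun t : ℝ => Complex.exp (-(Complex.I * z / ω) * t))
        (Complex.exp (-(Complex.I * z / ω) * θ) * (-(Complex.I * z / ω))) θ := by
      have h2 := ((Complex.ofRealCLM.hasDerivAt (x := θ)).const_mul (-(Complex.I * z / ω))).cexp
      simpa using! h2
    refine (h1.mul (hderiv j θ)).congr_deriv ?_
    simp only [generator, boxFamily, Matrix.neg_mulVec, Matrix.smul_mulVec, Matrix.add_mulVec,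
      Pi.neg_apply, Pi.smul_apply, Pi.add_apply, smul_eq_mul, realDiag, Matrix.mulVec_diagonal, w]
    rw [Matrix.mulVec, dotProduct]
    simp only [Matrix.of_apply]
    have e : ∑ i : Λ, laplacian (j : Fin d → ℤ) i *
        (Complex.exp (-(Complex.I * z / ω) * θ) * h θ i) =
        Complex.exp (-(Complex.I * z / ω) * θ) * ∑ i : Λ, laplacian (j : Fin d → ℤ) i * h θ i := by
      rw [Finset.mul_sum]
      exact Finset.sum_congr rfl fun i _ => by ring
    rw [e]
    push_cast
    field_simp
    ring
  have hflow := hG.eq_flow_mulVec (γ / ω) (fun j : Λ => v j) hw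
  -- If `w 0 = 0`, uniqueness makes `w` vanish identically, hence all Fourier series of $\psi$
  -- vanish.
  refine ⟨w 0, fun h0 => hψ0 ?_, ?_⟩
  · ext1 j
    refine eq_zero_of_tsum_expFun_eq_zero (hxs j) fun θ => ?_
    have h1 := congrFun (hflow θ) j
    rw [h0, Matrix.mulVec_zero] at h1
    exact (mul_eq_zero.1 h1).resolve_left (Complex.exp_ne_zero _)
  · change (flow _ _ _ 1).mulVec (w 0) = _
    rw [← hflow 1]
    funext j
    simp [w, h, expFun_zero_right, expFun_one_right]

end Box

/-! ### The probability estimate. -/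

theorem norm_one_sub_mul_exp_le {t : ℝ} (h0 : 0 ≤ t) (h1 : t ≤ 1 / 2) {s : ℂ} (hs : ‖s‖ ≤ 2 * t) :
    ‖1 - ((1 - t : ℝ) : ℂ) * Complex.exp s‖ ≤ 5 * t := by
  -- $|e^s-1|\le2|s|\le4t$; the fifth $t$ comes from $1-(1-t)$.
  have h2 := Complex.norm_exp_sub_one_le (x := s) (by linarith)
  have e : 1 - ((1 - t : ℝ) : ℂ) * Complex.exp s =
      (t : ℂ) - ((1 - t : ℝ) : ℂ) * (Complex.exp s - 1) := by
    push_cast; ring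
  rw [e]
  refine (norm_sub_le _ _).trans ?_
  rw [norm_mul, Complex.norm_of_nonneg h0, Complex.norm_of_nonneg (by linarith : (0 : ℝ) ≤ 1 - t)]
  nlinarith [norm_nonneg (Complex.exp s - 1), norm_nonneg s]

variable {d : ℕ} {Λ : Finset (Fin d → ℤ)} {ω γ lam : ℝ} {W : (Fin d → ℤ) → ℝ}

/-- If the energy is close to the spectrum, the monodromy matrix has an eigenvalue close to the
corresponding point of the unit circle. -/
theorem exists_eigenvalue_near {v : (Fin d → ℤ) → ℝ} {E ε : ℝ} (hω : 0 < ω) (hε : 0 < ε)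
    (hεω : 2 * ε ≤ ω)
    (h : Metric.infEDist (E : ℂ) (unboundedSpectrum (quasiEnergy Λ ω γ lam v W)) ≤
      ENNReal.ofReal ε) :
    ∃ c : Λ → ℂ, c ≠ 0 ∧ ∃ μ : ℂ,
      (monodromy (boxFamily Λ ω lam W) (γ / ω) fun j : Λ => v j).mulVec c = μ • c ∧
      ‖1 - ((1 - ε / ω : ℝ) : ℂ) * Complex.exp ((E / ω : ℝ) * Complex.I) * μ‖ ≤ 5 * (ε / ω) := by
  -- Whether the infimum is attained is left open; doubling the radius produces an actual spectral
  -- point.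
  have hlt : ENNReal.ofReal ε < ENNReal.ofReal (2 * ε) :=
    (ENNReal.ofReal_lt_ofReal_iff (by linarith)).2 (by linarith)
  obtain ⟨z, hz, hEz⟩ := Metric.infEDist_lt_iff.1 (h.trans_lt hlt)
  rw [edist_lt_ofReal, dist_eq_norm] at hEz
  obtain ⟨c, hc, hμ⟩ := exists_monodromy_eigenvector hω hz
  refine ⟨c, hc, _, hμ, ?_⟩
  have hω' : (ω : ℂ) ≠ 0 := by exact_mod_cast hω.ne'
  have e : Complex.exp ((E / ω : ℝ) * Complex.I) * Complex.exp (-(Complex.I * z / ω)) =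
      Complex.exp (Complex.I * (((E : ℂ) - z) / ω)) := by
    rw [← Complex.exp_add]
    congr 1
    push_cast
    field_simp
    ring
  rw [mul_assoc, e]
  refine norm_one_sub_mul_exp_le (by positivity) ?_ ?_
  · rw [div_le_iff₀ hω]; linarith
  · rw [norm_mul, Complex.norm_I, one_mul, norm_div, Complex.norm_of_nonneg hω.le, ← mul_div_assoc]
    gcongr

theorem potentialLaw_le_of_two_mul_le {g : Measure ℝ} [IsProbabilityMeasure g] {M : ℝ≥0}
    (hM : g ≤ (M : ℝ≥0∞) • volume.restrict (Icc (-1) 1)) {E ε : ℝ} (hω : 0 < ω) (hγ : 0 < γ)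
    (hε : 0 < ε) (hεω : 2 * ε ≤ ω) :
    potentialLaw d g {v | Metric.infEDist (E : ℂ)
        (unboundedSpectrum (quasiEnergy Λ ω γ lam v W)) ≤ ENNReal.ofReal ε} ≤
      ENNReal.ofReal (25 * (ε / ω) * (Λ.card * (M * (2 + 2 * (ω / γ) * (Λ.card * Real.pi))))) := by
  set t := ε / ω with ht
  have ht0 : 0 < t := by positivity
  have ht1 : t ≤ 1 / 2 := by rw [ht, div_le_iff₀ hω]; linarith
  set ρ : ℂ := ((1 - t : ℝ) : ℂ) * Complex.exp ((E / ω : ℝ) * Complex.I) with hρ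
  have hρn : ‖ρ‖ = 1 - t := by
    rw [hρ, norm_mul, Complex.norm_exp_ofReal_mul_I, mul_one, Complex.norm_of_nonneg (by linarith)]
  have hmeas := (isHermitianFamily_boxFamily Λ ω lam W).measure_eigenvalue_le
    (div_pos hγ hω) (ρ := ρ) (by rw [hρn]; linarith) hM (5 * t)
  set T : Set (Λ → ℝ) := {v | ∃ c : Λ → ℂ, c ≠ 0 ∧ ∃ μ : ℂ,
    (monodromy (boxFamily Λ ω lam W) (γ / ω) v).mulVec c = μ • c ∧ ‖1 - ρ * μ‖ ≤ 5 * t} with hT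
  calc potentialLaw d g {v | Metric.infEDist (E : ℂ)
        (unboundedSpectrum (quasiEnergy Λ ω γ lam v W)) ≤ ENNReal.ofReal ε}
      ≤ potentialLaw d g (Λ.restrict ⁻¹' T) :=
        measure_mono fun v hv => exists_eigenvalue_near hω hε hεω hv
    _ ≤ (potentialLaw d g).map Λ.restrict T :=
        -- This inequality holds for every set, so measurability of `T` is not needed.
        Measure.le_map_apply
          (Finset.measurable_restrict (X := fun _ : Fin d → ℤ => ℝ) Λ).aemeasurable T
    _ = Measure.pi (fun _ : Λ => g) T := by
        rw [potentialLaw, Measure.infinitePi_map_restrict]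
    _ ≤ _ := hmeas
    _ ≤ _ := by
        apply ENNReal.ofReal_le_ofReal
        rw [Fintype.card_coe, hρn]
        -- $1-(1-t)^2=t(2-t)\ge t$: one of the two powers of $t$ survives.
        have h1 : (5 * t) ^ 2 / (1 - (1 - t) ^ 2) ≤ 25 * t := by
          rw [div_le_iff₀ (by nlinarith)]
          nlinarith [mul_pos ht0 ht0]
        have h2 : 2 / (γ / ω) = 2 * (ω / γ) := by field_simp
        rw [h2]
        gcongr

end QuasiEnergy

end

theorem lemma2p2 (lam : ℝ) (g : Measure ℝ) [IsProbabilityMeasure g]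
    (hg_supp : g.support ⊆ Set.Icc (-1) 1) (hg_dens : QuasiEnergy.HasBoundedDensity g) :
    ∃ C : ℝ, 0 < C ∧
      ∀ (d : ℕ), 1 ≤ d →
      ∀ (γ ω : ℝ), 0 < γ → 0 < ω → ω ≤ 2 * d + γ →
      ∀ (b : ℝ), 0 < b →
      ∀ (W : (Fin d → ℤ) → ℝ),
        (∀ j, |W j| ≤ Real.exp (-b * Real.log γ * (QuasiEnergy.l1Norm j : ℝ))) →
      ∀ (Λ : Finset (Fin d → ℤ)) (E ε : ℝ), 0 < ε →
        QuasiEnergy.potentialLaw d g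
            {v | Metric.infEDist (E : ℂ) (QuasiEnergy.unboundedSpectrum (QuasiEnergy.quasiEnergy Λ ω γ lam v W))
              ≤ ENNReal.ofReal ε}
          ≤ ENNReal.ofReal (C * (ε / ω) * (Λ.card : ℝ) ^ 4 * ((2 * d + γ) / γ)) := by
  obtain ⟨M, hM⟩ := hg_dens.exists_le_smul_restrict hg_supp
  -- The first summand serves $2\epsilon\le\omega$. The summand 2 makes the right side at least 1
  -- when $2\epsilon>\omega$ and the box is nonempty.
  refine ⟨50 * (1 + Real.pi) * M + 2, by positivity, ?_⟩
  intro d _ γ ω hγ hω hωγ b _ W _ Λ E ε hε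
  have hq : 1 ≤ (2 * d + γ) / γ := by
    rw [le_div_iff₀ hγ]
    have : (0 : ℝ) ≤ d := Nat.cast_nonneg d
    linarith
  have hωq : ω / γ ≤ (2 * d + γ) / γ := by gcongr
  rcases Finset.eq_empty_or_nonempty Λ with hΛ | hΛ
  -- For an empty box the right side is 0, and so is the probability: the spectrum is empty and the
  -- distance to it is infinite.
  · have hempty : {v | Metric.infEDist (E : ℂ) (QuasiEnergy.unboundedSpectrum
        (QuasiEnergy.quasiEnergy Λ ω γ lam v W)) ≤ ENNReal.ofReal ε} = ∅ := by
      refine Set.eq_empty_of_forall_notMem fun v hv => ?_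
      obtain ⟨z, hz, -⟩ := Metric.infEDist_lt_iff.1 (lt_of_le_of_lt hv ENNReal.ofReal_lt_top)
      obtain ⟨c, hc, -⟩ := QuasiEnergy.exists_monodromy_eigenvector hω hz
      subst hΛ
      exact hc (Subsingleton.elim _ _)
    rw [hempty, measure_empty]
    exact zero_le
  have hN : (1 : ℝ) ≤ Λ.card := by exact_mod_cast hΛ.card_pos
  rcases le_or_gt (2 * ε) ω with h | h
  · refine (QuasiEnergy.potentialLaw_le_of_two_mul_le hM hω hγ hε h).trans
      (ENNReal.ofReal_le_ofReal ?_)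
    set N : ℝ := (Λ.card : ℝ)
    set q : ℝ := (2 * d + γ) / γ
    have hN4 : N ^ 2 ≤ N ^ 4 := pow_le_pow_right₀ hN (by norm_num)
    have h1 : 2 + 2 * (ω / γ) * (N * Real.pi) ≤ 2 * (1 + Real.pi) * (N * q) := by
      have h2 : 1 ≤ N * q := one_le_mul_of_one_le_of_one_le hN hq
      have h3 : ω / γ * (N * Real.pi) ≤ q * (N * Real.pi) := by gcongr
      linarith
    calc 25 * (ε / ω) * (N * (M * (2 + 2 * (ω / γ) * (N * Real.pi))))
        ≤ 25 * (ε / ω) * (N * (M * (2 * (1 + Real.pi) * (N * q)))) := by gcongr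
      _ = 50 * (1 + Real.pi) * M * (ε / ω) * N ^ 2 * q := by ring
      _ ≤ (50 * (1 + Real.pi) * M + 2) * (ε / ω) * N ^ 4 * q := by
        gcongr
        linarith
  · have hprob : IsProbabilityMeasure (QuasiEnergy.potentialLaw d g) := by
      unfold QuasiEnergy.potentialLaw; infer_instance
    refine prob_le_one.trans (ENNReal.one_le_ofReal.2 ?_)
    have h1 : 1 ≤ (50 * (1 + Real.pi) * M + 2) * (ε / ω) := by
      have h2 : 1 ≤ 2 * (ε / ω) := by rw [← mul_div_assoc, le_div_iff₀ hω]; linarith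
      have h3 : 0 ≤ 50 * (1 + Real.pi) * M * (ε / ω) := by positivity
      linarith
    exact one_le_mul_of_one_le_of_one_le (one_le_mul_of_one_le_of_one_le h1 (one_le_pow₀ hN)) hq
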